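/- Let $n\ge 1$, let $D$ be the flat affine connection on $\mathbb{R}^{n+1}$, and fix a nonzero parallel volume form $\Psi$. For smooth $F$ write $F_{i_1\dots i_k}=D_{i_1}\cdots D_{i_{k-1}}dF_{i_k}$ and $g_{ij}=F_{ij}$. Define $H(F)$ by $\det(F_{ij})=H(F)\Psi^2$, let $U^{ij}$ be the adjugate bivector, $U^{ip}F_{pj}=H(F)\delta_j{}^i$, and put $U(F)=U^{ij}F_iF_j$. Where $H(F)\neq 0$ let $g^{ij}$ be the inverse of $g_{ij}$, $F^i=g^{ij}F_j$, and $F_{ip}{}^{j}=g^{jq}F_{ipq}$. Where also $U(F)\ne0$ let $$\mu_i=\tfrac1{n+2}\,U(F)^{-1}d_iU(F),\qquad A(F)=1-F^p\mu_p,\qquad \nu_i=-|U(F)|^{-1/(n+2)}F_i ;$$ $\nu$ is the equiaffine conormal. Write $d\log H(F)=H(F)^{-1}dH(F)$. For a vector field $N$ transverse to a hypersurface, the induced connection $\nabla$, second fundamental form $h$, shape operator $S$ and connection one-form $\tau$ are defined by $D_XY=\nabla_XY+h(X,Y)N$ and $D_XN=-S(X)+\tau(X)N$ for $X,Y$ tangent.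 The equiaffine normal of a nondegenerate co-oriented hypersurface is the transverse field $N$, consistent with the co-orientation, for which $\tau=0$ and $|\Psi(N,X_1,\dots,X_n)|^2=|\det h(X_i,X_j)|$ for all tangent $X_1,\dots,X_n$. Its shape operator is the affine shape operator, and $\frac1n\operatorname{tr}S$ is the affine mean curvature. **Lemma.** Let $\Omega\subset\mathbb{R}^{n+1}$ and $I\subset\mathbb{R}$ be connected open sets, and let $F\in C^\infty(\Omega)$ be such that neither $H(F)$ nor $U(F)$ vanishes on $\Omega_I=F^{-1}(I)\cap\Omega$. For $r\in I$ let $L_r=\{x\in\Omega_I: F(x)=r\}$, co-oriented by $-\operatorname{sign}(U(F)H(F))F^i$. The equiaffine normals of the level sets $L_r$ form a smooth vector field $N$ on $\Omega_I$, and the following are equivalent: 1. $U(F)$ is locally constant on $L_r$ for each $r\in I$. 2. $\mu\wedge\nu=0$; equivalently, $\mu_i=U(F)^{-1}H(F)(1-A(F))F_i$. 3. $d\nu=0$. 4. The local flow $\phi_t$ of $N$ on $\Omega_I$ preserves the level sets of $F$, in the sense that for each $t$ the function $F\circ\phi_t$ is locally constant on the intersection of each $L_r$ with the domain of $\phi_t$.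 5. $\mathcal{L}_N\nu=0$. 6. $N^i$ is at each point of $\Omega_I$ a multiple of $F^i$; equivalently, $N^i=-\operatorname{sign}(U(F))\,H(F)\,|U(F)|^{-(n+1)/(n+2)}F^i$. If these conditions hold, then the affine mean curvature of $L_r$ is the restriction of $$\tfrac{n+2}{n}\operatorname{sign}(U(F))\,H(F)\,|U(F)|^{-(n+1)/(n+2)}A(F),$$ and the tensor $$S_i{}^j=-D_iN^j+\operatorname{sign}(U(F))\,|U(F)|^{-(n+1)/(n+2)}H(F)A(F)\,\nu_iN^j$$ is equal to $$\operatorname{sign}(U(F))H(F)|U(F)|^{-\frac{n+1}{n+2}}\Big(\delta_i{}^j-F_{ip}{}^jF^p+\big(d_i\log H(F)+U(F)^{-1}H(F)\big((n+2)A(F)-(n+1)\big)F_i\big)F^j\Big),$$ satisfies $F_jS_i{}^j=0$, and restricts along each $L_r$ to the affine shape operator of $L_r$. -/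

import Mathlib

open Set Filter Topology
open scoped ContDiff

namespace LevelSetAffine

noncomputable section

/-- The space `ℝ^{n+1}`, with its standard (affine) coordinates. -/
abbrev Space (n : ℕ) : Type := Fin (n + 1) → ℝ

/-- A parallel volume form on `ℝ^{n+1}`, i.e. a constant alternating form of top degree. -/
abbrev VolForm (n : ℕ) : Type := AlternatingMap ℝ (Space n) ℝ (Fin (n + 1))

/-- The standard basis vector `e_i`. -/
def basisVec {n : ℕ} (i : Fin (n + 1)) : Space n := Pi.single i 1

/-- The `i`-th partial derivative. -/
def pd {n : ℕ} (i : Fin (n + 1)) (f : Space n → ℝ) (x : Space n) : ℝ :=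
  fderiv ℝ f x (basisVec i)

/-- The components `F_i` of `dF`. -/
def grad {n : ℕ} (F : Space n → ℝ) (x : Space n) : Fin (n + 1) → ℝ :=
  fun i => pd i F x

/-- The Hessian `g_{ij} = F_{ij}`. -/
def hess {n : ℕ} (F : Space n → ℝ) (x : Space n) : Matrix (Fin (n + 1)) (Fin (n + 1)) ℝ :=
  Matrix.of fun i j => pd i (pd j F) x

/-- The third derivatives `F_{ijk}`. -/
def third {n : ℕ} (F : Space n → ℝ) (x : Space n) (i j k : Fin (n + 1)) : ℝ :=
  pd i (pd j (pd k F)) x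

/-- The Hessian determinant `H(F)`, defined by `det Hess F = H(F) Ψ²`. -/
def hessDet {n : ℕ} (Ψ : VolForm n) (F : Space n → ℝ) (x : Space n) : ℝ :=
  (hess F x).det / (Ψ basisVec) ^ 2

/-- The adjugate bivector `U^{ij}`, satisfying `U^{ip} F_{pj} = H(F) δ_j^i`. -/
def adjHess {n : ℕ} (Ψ : VolForm n) (F : Space n → ℝ) (x : Space n) :
    Matrix (Fin (n + 1)) (Fin (n + 1)) ℝ :=
  ((Ψ basisVec) ^ 2)⁻¹ • (hess F x).adjugate

/-- `U(F) = U^{ij} F_i F_j`. -/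
def uFun {n : ℕ} (Ψ : VolForm n) (F : Space n → ℝ) (x : Space n) : ℝ :=
  ∑ i, ∑ j, adjHess Ψ F x i j * grad F x i * grad F x j

/-- The vector field `F^i = g^{ij} F_j`. -/
def hessGrad {n : ℕ} (F : Space n → ℝ) (x : Space n) : Space n :=
  fun i => ∑ j, (hess F x)⁻¹ i j * grad F x j

/-- The one-form `μ = (n+2)⁻¹ d log U(F)`, where `d log f` means `f⁻¹ df`. -/
def muForm {n : ℕ} (Ψ : VolForm n) (F : Space n → ℝ) (x : Space n) : Space n →L[ℝ] ℝ :=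
  (1 / ((n : ℝ) + 2) * (uFun Ψ F x)⁻¹) • fderiv ℝ (uFun Ψ F) x

/-- The function `A(F) = 1 - F^p μ_p`. -/
def aFun {n : ℕ} (Ψ : VolForm n) (F : Space n → ℝ) (x : Space n) : ℝ :=
  1 - muForm Ψ F x (hessGrad F x)

/-- The equiaffine conormal one-form `ν = -|U(F)|^{-1/(n+2)} dF`. -/
def conormal {n : ℕ} (Ψ : VolForm n) (F : Space n → ℝ) (x : Space n) : Space n →L[ℝ] ℝ :=
  (-(|uFun Ψ F x| ^ (-(1 / ((n : ℝ) + 2))))) • fderiv ℝ F x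

/-- `|U(F)|^{-(n+1)/(n+2)} sign(U(F)) H(F)`. -/
def normalFactor {n : ℕ} (Ψ : VolForm n) (F : Space n → ℝ) (x : Space n) : ℝ :=
  Real.sign (uFun Ψ F x) * hessDet Ψ F x *
    |uFun Ψ F x| ^ (-(((n : ℝ) + 1) / ((n : ℝ) + 2)))

/-- The part of the `r`-level set of `F` that lies in `W`. -/
def levelSet {n : ℕ} (F : Space n → ℝ) (W : Set (Space n)) (r : ℝ) : Set (Space n) :=
  {x | x ∈ W ∧ F x = r}

/-- The tangent space at `x` to the level set of `F` through `x`. -/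
abbrev tangent {n : ℕ} (F : Space n → ℝ) (x : Space n) : Submodule ℝ (Space n) :=
  LinearMap.ker (fderiv ℝ F x).toLinearMap

/-- `h`, `S` and `τ` are, at the point `x`, the second fundamental form, the shape operator and
the connection one-form of the level set of `F` through `x` that are determined by the
transverse vector field `N` and the flat connection `D` through the splitting of
`ℝ^{n+1}` into the tangent space and the span of `N`:
`D_X Y = ∇_X Y + h(X, Y) N` and `D_X N = -S(X) + τ(X) N` for `X`, `Y` tangent,
where `∇_X Y` and `S(X)` are tangent. -/
structure IsInduced {n : ℕ} (F : Space n → ℝ) (N : Space n → Space n) (x : Space n)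
    (h : LinearMap.BilinForm ℝ (tangent F x))
    (S : tangent F x →ₗ[ℝ] tangent F x) (τ : tangent F x →ₗ[ℝ] ℝ) : Prop where
  transverse : N x ∉ tangent F x
  gauss : ∀ Y : Space n → Space n, ContDiffAt ℝ ∞ Y x →
    (∀ᶠ y in 𝓝 x, Y y ∈ tangent F y) →
    ∀ X Yx : tangent F x, (Yx : Space n) = Y x →
      fderiv ℝ Y x X - h X Yx • N x ∈ tangent F x
  weingarten : ∀ X : tangent F x, fderiv ℝ N x X = -(S X : Space n) + τ X • N x

/-- The vector field `N` restricts to every level set of `F` in `W` as its equiaffine normal with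
respect to `Ψ`: the induced connection one-form vanishes, and the induced volume form
`ι(N)Ψ` is, up to sign, the volume form of the induced second fundamental form `h`. The sign of
`N` is fixed by the co-orientation of the level sets: `N` points to the same side as
`-sign(U(F) H(F)) F^i`. -/
structure IsEquiaffineNormal {n : ℕ} (Ψ : VolForm n) (F : Space n → ℝ) (W : Set (Space n))
    (N : Space n → Space n) : Prop where
  smooth : ContDiffOn ℝ ∞ N W
  normalized : ∀ x ∈ W, ∃ (h : LinearMap.BilinForm ℝ (tangent F x))
    (S : tangent F x →ₗ[ℝ] tangent F x) (τ : tangent F x →ₗ[ℝ] ℝ),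
    IsInduced F N x h S τ ∧ τ = 0 ∧
      ∀ X : Fin n → tangent F x,
        |(Matrix.of fun i j => h (X i) (X j)).det| =
          (Ψ (Fin.cons (N x) fun i => (X i : Space n))) ^ 2
  cooriented : ∀ x ∈ W,
    0 < fderiv ℝ F x (N x) *
      fderiv ℝ F x (-(Real.sign (uFun Ψ F x * hessDet Ψ F x)) • hessGrad F x)

/-- `S` is the affine shape operator at `x` of the level set of `F` through `x`, when `N` is the
equiaffine normal. -/
def IsShapeOperator {n : ℕ} (F : Space n → ℝ) (N : Space n → Space n) (x : Space n)
    (S : tangent F x →ₗ[ℝ] tangent F x) : Prop :=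
  ∃ (h : LinearMap.BilinForm ℝ (tangent F x)) (τ : tangent F x →ₗ[ℝ] ℝ), IsInduced F N x h S τ

/-- The mean curvature `n⁻¹ tr S` of a hypersurface in `ℝ^{n+1}` with shape operator `S`. -/
def meanCurvature {n : ℕ} {F : Space n → ℝ} {x : Space n}
    (S : tangent F x →ₗ[ℝ] tangent F x) : ℝ :=
  1 / (n : ℝ) * LinearMap.trace ℝ (tangent F x) S

/-- The exterior product of two one-forms. -/
def wedge {n : ℕ} (α β : Space n → Space n →L[ℝ] ℝ) (x u v : Space n) : ℝ :=
  α x u * β x v - α x v * β x u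

/-- The exterior derivative of a one-form. -/
def extD {n : ℕ} (α : Space n → Space n →L[ℝ] ℝ) (x : Space n) :
    Space n [⋀^Fin 2]→L[ℝ] ℝ :=
  extDeriv (fun y => ContinuousAlternatingMap.ofSubsingleton ℝ (Space n) ℝ (0 : Fin 1) (α y)) x

/-- The Lie derivative of the one-form `α` along the vector field `N`,
`(L_N α)_i = N^p ∂_p α_i + α_p ∂_i N^p`. -/
def lieD {n : ℕ} (N : Space n → Space n) (α : Space n → Space n →L[ℝ] ℝ) (x : Space n) :
    Space n →L[ℝ] ℝ :=
  fderiv ℝ α x (N x) + (α x).comp (fderiv ℝ N x)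

/-- The local flow on `W` of the vector field `N` is defined at time `t` at `x` and takes
`x` to `y`. -/
def FlowsTo {n : ℕ} (W : Set (Space n)) (N : Space n → Space n) (t : ℝ) (x y : Space n) : Prop :=
  ∃ γ : ℝ → Space n, γ 0 = x ∧ γ t = y ∧ (∀ s ∈ uIcc 0 t, γ s ∈ W) ∧
    IsIntegralCurveOn γ (fun _ => N) (uIcc 0 t)

/-- The local flow `φ_t` of `N` on `W` preserves the foliation of `W` by the level sets of `F`:
for every `t`, the function `F ∘ φ_t` is locally constant along the level sets of `F`
in the (open) domain of `φ_t`. -/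
def FlowPreservesLevelSets {n : ℕ} (F : Space n → ℝ) (W : Set (Space n))
    (N : Space n → Space n) : Prop :=
  ∀ (t : ℝ) (x y : Space n), FlowsTo W N t x y →
    ∀ᶠ x' in 𝓝 x, F x' = F x → ∀ y', FlowsTo W N t x' y' → F y' = F y

/-- The endomorphism field
`S_i^j = -D_i N^j + sign(U(F)) |U(F)|^{-(n+1)/(n+2)} H(F) A(F) ν_i N^j`. -/
def shapeTensor {n : ℕ} (Ψ : VolForm n) (F : Space n → ℝ) (N : Space n → Space n)
    (x : Space n) : Space n →L[ℝ] Space n :=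
  -fderiv ℝ N x +
    (normalFactor Ψ F x * aFun Ψ F x) • (conormal Ψ F x).smulRight (N x)

/-- The components in terms of `F` of the endomorphism field,
`sign(U) H |U|^{-(n+1)/(n+2)} (δ_i^j - F_{ip}^j F^p
  + (d_i log H + U⁻¹ H ((n+2) A - (n+1)) F_i) F^j)`. -/
def shapeComponents {n : ℕ} (Ψ : VolForm n) (F : Space n → ℝ) (x : Space n)
    (i j : Fin (n + 1)) : ℝ :=
  normalFactor Ψ F x *
    ((if i = j then 1 else 0)
      - ∑ p, ∑ q, third F x i p q * (hess F x)⁻¹ q j * hessGrad F x p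
      + ((hessDet Ψ F x)⁻¹ * pd i (hessDet Ψ F) x
          + (uFun Ψ F x)⁻¹ * hessDet Ψ F x *
            (((n : ℝ) + 2) * aFun Ψ F x - ((n : ℝ) + 1)) * grad F x i) * hessGrad F x j)

end

end LevelSetAffine

/-! Write `f = |U(F)|^{1/(n+2)}` and `F^♯` for the field `F^i`. Then `dF(F^♯) = U/H`, so on `W` the
form `dF` never vanishes and `F^♯` is transverse to the level sets; moreover `μ = d log f`.

The equiaffine normal is governed by two first-order facts. The volume normalization together with
the co-orientation says `dF(N) = -f` (`IsEquiaffineNormal.fderiv_apply`), and `τ = 0` says that `D_X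
N` is tangent for tangent `X`. Differentiating the first and using the second gives `g(N, X) = -f
μ(X)` for tangent `X`, while `g(N, F^♯) = dF(N) = -f`. Since `F^♯` and the tangent space span, `g(N,
·) = -f (μ + A H U⁻¹ dF)` (`IsEquiaffineNormal.hessForm_apply`). This determines `N`, and raising
the index gives its existence.

All the conditions reduce to one pointwise statement: `μ` is a multiple of `dF` everywhere on `W`.
For `N ∥ F^♯` this is the formula for `g(N, ·)`; for `dν` it is `dν = -μ ∧ ν`; for the Lie
derivative it is `L_N ν = μ + f⁻¹ μ(N) dF`. Local constancy of `U` yields it by Lagrange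
multipliers, and conversely a function whose differential kills `ker dF` is locally a Lipschitz
function of `F`. For the flow, `F` changes at the rate `dF(N) = -f`: if `f` is locally a Lipschitz
function of `F`, a Gronwall argument keeps level sets together, and conversely differentiating at `t
= 0` shows that `f` is locally constant on them.

Under these conditions `N` is an explicit multiple of `F^♯`, so the shape tensor is obtained by
differentiation. It takes values in the tangent space, so its full trace is the trace of the shape
operator, and Jacobi's formula removes the third derivatives from that trace. -/

namespace LevelSetAffine

/-! ### Functions near a regular point of `F`. -/

section Straightening

variable {E : Type*} [NormedAddCommGroup E] [NormedSpace ℝ E] [CompleteSpace E]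

/-- Near a regular point a `C^1` function is linear in suitable `C^1` coordinates. -/
lemma exists_straightening {F : E → ℝ} {p : E} (hF : ContDiffAt ℝ 1 F p)
    (hp : fderiv ℝ F p ≠ 0) :
    ∃ (Φ ψ : E → E) (l : E →L[ℝ] ℝ) (w : E), l w = 1 ∧ ContinuousAt Φ p ∧
      ContDiffAt ℝ 1 ψ (Φ p) ∧ ψ (Φ p) = p ∧ (∀ᶠ y in 𝓝 p, ψ (Φ y) = y) ∧
      (∀ y, l (Φ y) = F y) ∧ ∀ᶠ z in 𝓝 (Φ p), F (ψ z) = l z := by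
  obtain ⟨w, hw⟩ : ∃ w, fderiv ℝ F p w = 1 := by
    obtain ⟨v, hv⟩ : ∃ v, fderiv ℝ F p v ≠ 0 := by
      by_contra! h
      exact hp (ContinuousLinearMap.ext h)
    exact ⟨(fderiv ℝ F p v)⁻¹ • v, by simp [hv]⟩
  set l := fderiv ℝ F p with hl
  -- The correction has zero derivative at `p`, so `Φ` has derivative the identity there, and `l w =
  -- 1` forces `l ∘ Φ = F`.
  set Φ : E → E := fun y => y + (F y - l y) • w with hΦ
  have hc : ContDiffAt ℝ 1 Φ p :=
    contDiffAt_id.add ((hF.sub l.contDiff.contDiffAt).smul contDiffAt_const)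
  have hd : HasFDerivAt Φ ((ContinuousLinearEquiv.refl ℝ E : E ≃L[ℝ] E) : E →L[ℝ] E) p := by
    have h1 : HasFDerivAt F l p := (hF.differentiableAt (by simp)).hasFDerivAt
    have h2 := (hasFDerivAt_id (𝕜 := ℝ) p).add ((h1.sub l.hasFDerivAt).smul_const w)
    refine h2.congr_fderiv ?_
    ext v
    simp
  have hn : (1 : ℕ∞ω) ≠ 0 := by simp
  let e := hc.toOpenPartialHomeomorph Φ hd hn
  have he : p ∈ e.source := hc.mem_toOpenPartialHomeomorph_source hd hn
  have hlΦ : ∀ y, l (Φ y) = F y := fun y => by simp [hΦ, hw]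
  refine ⟨Φ, e.symm, l, w, hw, hc.continuousAt, hc.to_localInverse hd hn, e.left_inv he,
    ?_, hlΦ, ?_⟩
  · filter_upwards [e.open_source.mem_nhds he] with y hy using e.left_inv hy
  · filter_upwards [e.open_target.mem_nhds (e.map_source he)] with z hz
    rw [← hlΦ]
    exact congrArg l (e.right_inv hz)

/-- If `dU` vanishes on the kernel of `dF ≠ 0`, then locally `U` is a Lipschitz function of `F`. -/
lemma exists_abs_sub_le_of_fderiv_ker {F U : E → ℝ} {p : E} (hF : ContDiffAt ℝ 1 F p)
    (hU : ContDiffAt ℝ 1 U p) (hp : fderiv ℝ F p ≠ 0)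
    (h : ∀ᶠ y in 𝓝 p, ∀ v, fderiv ℝ F y v = 0 → fderiv ℝ U y v = 0) :
    ∃ L : ℝ, 0 ≤ L ∧ ∀ᶠ q in 𝓝 p ×ˢ 𝓝 p, |U q.1 - U q.2| ≤ L * |F q.1 - F q.2| := by
  obtain ⟨Φ, ψ, l, w, hlw, hΦ, hψ, hψp, hleft, hlΦ, hFψ⟩ := exists_straightening hF hp
  have hψc : Tendsto ψ (𝓝 (Φ p)) (𝓝 p) := by
    simpa [ContinuousAt, hψp] using hψ.continuousAt
  have hFe : ∀ᶠ y in 𝓝 p, DifferentiableAt ℝ F y :=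
    (hF.eventually (by simp)).mono fun y hy => hy.differentiableAt (by simp)
  have hUe : ∀ᶠ y in 𝓝 p, DifferentiableAt ℝ U y :=
    (hU.eventually (by simp)).mono fun y hy => hy.differentiableAt (by simp)
  have hψe : ∀ᶠ z in 𝓝 (Φ p), DifferentiableAt ℝ ψ z :=
    (hψ.eventually (by simp)).mono fun y hy => hy.differentiableAt (by simp)
  have key : ∀ᶠ z in 𝓝 (Φ p), HasFDerivAt (U ∘ ψ) (fderiv ℝ (U ∘ ψ) z) z ∧
      ∀ v, l v = 0 → fderiv ℝ (U ∘ ψ) z v = 0 := by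
    filter_upwards [hψe, hψc.eventually hFe, hψc.eventually hUe, hψc.eventually h,
      hFψ.eventually_nhds] with z h1 h2 h3 h4 h5
    refine ⟨(h3.comp z h1).hasFDerivAt, fun v hv => ?_⟩
    rw [fderiv_comp z h3 h1]
    apply h4
    have h6 : fderiv ℝ (F ∘ ψ) z = l := by
      rw [Filter.EventuallyEq.fderiv_eq (f₁ := F ∘ ψ) (f := l) h5]
      exact l.fderiv
    rw [fderiv_comp z h2 h1] at h6
    simpa using (congrArg (fun m : E →L[ℝ] ℝ => m v) h6).trans hv
  have hg : ContDiffAt ℝ 1 (U ∘ ψ) (Φ p) := ContDiffAt.comp _ (by rwa [hψp]) hψ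
  obtain ⟨K, s, hs, hK⟩ := hg.exists_lipschitzOnWith
  obtain ⟨r, hr, hball⟩ := Metric.mem_nhds_iff.1 (inter_mem hs key)
  refine ⟨K * ‖w‖, by positivity, ?_⟩
  have hΦ1 : Tendsto (fun q : E × E => Φ q.1) (𝓝 p ×ˢ 𝓝 p) (𝓝 (Φ p)) :=
    hΦ.tendsto.comp tendsto_fst
  have hΦ2 : Tendsto (fun q : E × E => Φ q.2) (𝓝 p ×ˢ 𝓝 p) (𝓝 (Φ p)) :=
    hΦ.tendsto.comp tendsto_snd
  -- This auxiliary point moves `Φ q.1` along `w` to the level of `Φ q.2`. The move costs a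
  -- Lipschitz constant times `|F q.1 - F q.2|`; the rest of the way lies in a level of `l`, where
  -- `U ∘ ψ` does not change.
  have hΦ3 : Tendsto (fun q : E × E => Φ q.1 + (l (Φ q.2) - l (Φ q.1)) • w) (𝓝 p ×ˢ 𝓝 p)
      (𝓝 (Φ p)) := by
    have := hΦ1.add ((((l.continuous.tendsto _).comp hΦ2).sub
      ((l.continuous.tendsto _).comp hΦ1)).smul_const w)
    simpa using this
  filter_upwards [hΦ1.eventually (Metric.ball_mem_nhds _ hr),
    hΦ2.eventually (Metric.ball_mem_nhds _ hr), hΦ3.eventually (Metric.ball_mem_nhds _ hr),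
    tendsto_fst.eventually hleft, tendsto_snd.eventually hleft] with q h1 h2 h3 h4 h5
  set z := Φ q.1
  set z' := Φ q.2
  set z'' := z + (l z' - l z) • w
  obtain ⟨c, hc, hc'⟩ := domain_mvt (f := U ∘ ψ) (s := Metric.ball (Φ p) r)
    (fun x hx => (hball hx).2.1.hasFDerivWithinAt) (convex_ball _ _) h2 h3
  have e1 : (U ∘ ψ) z'' = (U ∘ ψ) z' := by
    have := (hball ((convex_ball _ _).segment_subset h2 h3 hc)).2.2 (z'' - z')
      (by simp [z'', hlw])
    linarith
  have e2 := hK.dist_le_mul z (hball h1).1 z'' (hball h3).1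
  rw [e1, Real.dist_eq] at e2
  have e3 : dist z z'' = |F q.1 - F q.2| * ‖w‖ := by
    rw [dist_eq_norm, ← hlΦ, ← hlΦ, abs_sub_comm]
    simp [z'', norm_smul, z, z']
  rw [e3] at e2
  simp only [Function.comp, z, z', h4, h5] at e2
  linarith

/-- Near a regular point of `F`, a function that is locally constant along the level sets of `F`
takes the same value at any two points of the same level set. -/
lemma exists_mem_nhds_forall_eq_of_locallyConstant {F : E → ℝ} {p : E} (hF : ContDiffAt ℝ 1 F p)
    (hp : fderiv ℝ F p ≠ 0) {V : Set E} (hV : V ∈ 𝓝 p) :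
    ∃ V' ∈ 𝓝 p, ∀ a ∈ V', ∀ b ∈ V', F a = F b → ∀ g : E → ℝ,
      (∀ y ∈ V, ∀ᶠ y' in 𝓝 y, F y' = F y → g y' = g y) → g a = g b := by
  obtain ⟨Φ, ψ, l, w, hlw, hΦ, hψ, hψp, hleft, hlΦ, hFψ⟩ := exists_straightening hF hp
  have hψc : Tendsto ψ (𝓝 (Φ p)) (𝓝 p) := by
    simpa [ContinuousAt, hψp] using hψ.continuousAt
  have hψe : ∀ᶠ z in 𝓝 (Φ p), ContinuousAt ψ z :=
    (hψ.eventually (by simp)).mono fun y hy => hy.continuousAt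
  obtain ⟨r, hr, hball⟩ := Metric.mem_nhds_iff.1
    (inter_mem (inter_mem hψe hFψ) (hψc hV))
  refine ⟨_, inter_mem hleft (hΦ.preimage_mem_nhds (Metric.ball_mem_nhds _ hr)), ?_⟩
  rintro a ⟨ha1, ha2⟩ b ⟨hb1, hb2⟩ hab g hg
  -- In straightened coordinates the level set is flat, so a segment joins the two points inside it,
  -- and a locally constant function on a connected interval is constant.
  let c : unitInterval → E := fun θ => AffineMap.lineMap (Φ a) (Φ b) (θ : ℝ)
  have hcc : Continuous c := AffineMap.lineMap_continuous.comp continuous_subtype_val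
  have hcb : ∀ θ, c θ ∈ Metric.ball (Φ p) r := fun θ =>
    (convex_ball (Φ p) r).segment_subset ha2 hb2
      (by rw [segment_eq_image_lineMap]; exact mem_image_of_mem _ θ.2)
  have hcl : ∀ θ, F (ψ (c θ)) = F a := fun θ => by
    rw [(hball (hcb θ)).1.2]
    simp [c, AffineMap.lineMap_apply, hlΦ, hab]
  have hlc : IsLocallyConstant (fun θ => g (ψ (c θ))) := by
    rw [IsLocallyConstant.iff_eventually_eq]
    intro θ
    have hct : ContinuousAt (fun θ => ψ (c θ)) θ :=
      ContinuousAt.comp (g := ψ) (hball (hcb θ)).1.1 hcc.continuousAt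
    filter_upwards [hct.eventually (hg _ (hball (hcb θ)).2)] with θ' h
    exact h (by rw [hcl, hcl])
  have := hlc.apply_eq_of_preconnectedSpace 0 1
  simpa [c, show ψ (Φ a) = a from ha1, show ψ (Φ b) = b from hb1] using this

/-- If `U` is constant near `p` on the level set of `F` through the regular point `p`, then `dU` is
a multiple of `dF` at `p`. -/
lemma exists_fderiv_eq_smul_of_locallyConstant {F U : E → ℝ} {p : E} (hF : ContDiffAt ℝ 1 F p)
    (hU : ContDiffAt ℝ 1 U p) (hp : fderiv ℝ F p ≠ 0)
    (h : ∀ᶠ y in 𝓝 p, F y = F p → U y = U p) :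
    ∃ c : ℝ, fderiv ℝ U p = c • fderiv ℝ F p := by
  -- A function locally constant on the constraint set has an extremum there, so Lagrange
  -- multipliers apply.
  have hext : IsLocalExtrOn U {x | F x = F p} p := by
    left
    filter_upwards [mem_nhdsWithin_of_mem_nhds h, self_mem_nhdsWithin] with y h1 h2
    exact (h1 h2).ge
  obtain ⟨a, b, hab, h0⟩ := hext.exists_multipliers_of_hasStrictFDerivAt_1d
    (hF.hasStrictFDerivAt (by simp)) (hU.hasStrictFDerivAt (by simp))
  have hb : b ≠ 0 := by
    rintro rfl
    have : a ≠ 0 := by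
      rintro rfl
      exact hab rfl
    exact hp (by simpa [this] using h0)
  refine ⟨-(b⁻¹ * a), ?_⟩
  have h1 : b • fderiv ℝ U p = -(a • fderiv ℝ F p) := eq_neg_of_add_eq_zero_right h0
  rw [neg_smul, mul_smul, ← smul_neg, ← h1, smul_smul, inv_mul_cancel₀ hb, one_smul]

end Straightening

end LevelSetAffine

namespace LevelSetAffine

/-! ### Flows that preserve the level sets of `F`. -/

section Flow

/-- A local estimate near the diagonal is uniform near the diagonal of a compact set. -/
lemma exists_uniform_le_mul_of_isCompact {E : Type*} [PseudoMetricSpace E] {K : Set E}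
    (hK : IsCompact K) {f g : E × E → ℝ} (hg : ∀ q, 0 ≤ g q)
    (h : ∀ p ∈ K, ∃ L : ℝ, 0 ≤ L ∧ ∀ᶠ q in 𝓝 p ×ˢ 𝓝 p, f q ≤ L * g q) :
    ∃ L : ℝ, 0 ≤ L ∧ ∃ ρ > 0, ∀ p ∈ K, ∀ q, dist q p < ρ → f (q, p) ≤ L * g (q, p) := by
  refine hK.induction_on (p := fun K => ∃ L : ℝ, 0 ≤ L ∧ ∃ ρ > 0, ∀ p ∈ K, ∀ q,
    dist q p < ρ → f (q, p) ≤ L * g (q, p)) ⟨0, le_rfl, 1, one_pos, by simp⟩ ?_ ?_ ?_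
  · rintro s t hst ⟨L, hL, ρ, hρ, H⟩
    exact ⟨L, hL, ρ, hρ, fun p hp => H p (hst hp)⟩
  · rintro s t ⟨L, hL, ρ, hρ, H⟩ ⟨L', hL', ρ', hρ', H'⟩
    refine ⟨max L L', le_max_of_le_left hL, min ρ ρ', lt_min hρ hρ', fun p hp q hq => ?_⟩
    rcases hp with hp | hp
    · exact (H p hp q (hq.trans_le (min_le_left _ _))).trans
        (mul_le_mul_of_nonneg_right (le_max_left _ _) (hg _))
    · exact (H' p hp q (hq.trans_le (min_le_right _ _))).trans
        (mul_le_mul_of_nonneg_right (le_max_right _ _) (hg _))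
  · intro p hp
    obtain ⟨L, hL, H⟩ := h p hp
    rw [← nhds_prod_eq, Metric.eventually_nhds_iff] at H
    obtain ⟨ε, hε, H⟩ := H
    refine ⟨Metric.ball p (ε / 2), mem_nhdsWithin_of_mem_nhds
      (Metric.ball_mem_nhds _ (by positivity)), L, hL, ε / 2, by positivity, fun a ha q hq => ?_⟩
    apply H
    rw [Prod.dist_eq]
    have ha' : dist a p < ε / 2 := ha
    have := dist_triangle q a p
    exact max_lt (by dsimp only; linarith) (by dsimp only; linarith)

lemma hasDerivWithinAt_Ici_of_Icc {E : Type*} [NormedAddCommGroup E] [NormedSpace ℝ E]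
    {γ : ℝ → E} {v : E} {a b s : ℝ} (h : HasDerivWithinAt γ v (Icc a b) s) (hs : s ∈ Ico a b) :
    HasDerivWithinAt γ v (Ici s) s :=
  h.mono_of_mem_nhdsWithin (Icc_mem_nhdsGE_of_mem hs)

/-- Rescaling time to `[0, 1]` treats positive, negative and zero `t` alike; the factor `t` passes
into the velocity. -/
lemma FlowsTo.exists_curve {n : ℕ} {W : Set (Space n)} {N : Space n → Space n} {t : ℝ}
    {x y : Space n} (h : FlowsTo W N t x y) :
    ∃ γ : ℝ → Space n, γ 0 = x ∧ γ 1 = y ∧ (∀ s ∈ Icc (0 : ℝ) 1, γ s ∈ W) ∧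
      ∀ s ∈ Icc (0 : ℝ) 1, HasDerivWithinAt γ (t • N (γ s)) (Icc 0 1) s := by
  obtain ⟨γ, h0, ht, hW, hγ⟩ := h
  have hmaps : MapsTo (fun s : ℝ => t * s) (Icc 0 1) (uIcc 0 t) := by
    intro s hs
    rcases le_total 0 t with h | h
    · rw [uIcc_of_le h]
      exact ⟨mul_nonneg h hs.1, mul_le_of_le_one_right h hs.2⟩
    · rw [uIcc_of_ge h]
      exact ⟨by nlinarith [hs.1, hs.2], mul_nonpos_of_nonpos_of_nonneg h hs.1⟩
  refine ⟨fun s => γ (t * s), by simpa using h0, by simpa using ht,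
    fun s hs => hW _ (hmaps hs), fun s hs => ?_⟩
  have h1 : HasDerivWithinAt (fun s : ℝ => t * s) t (Icc 0 1) s := by
    simpa using (hasDerivWithinAt_id s (Icc (0 : ℝ) 1)).const_mul t
  exact (hγ _ (hmaps hs)).scomp s h1 hmaps

/-- The Gronwall estimate for two integral curves, one of which starts close to the other, when the
Lipschitz estimate is only available in a tube about the second one. -/
lemma norm_sub_le_of_integralCurves {E : Type*} [NormedAddCommGroup E] [NormedSpace ℝ E]
    {v : E → E} {L ρ : ℝ} (hL : 0 ≤ L) {γ γ' : ℝ → E}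
    (hγ : ∀ s ∈ Icc (0 : ℝ) 1, HasDerivWithinAt γ (v (γ s)) (Icc 0 1) s)
    (hγ' : ∀ s ∈ Icc (0 : ℝ) 1, HasDerivWithinAt γ' (v (γ' s)) (Icc 0 1) s)
    (hv : ∀ s ∈ Icc (0 : ℝ) 1, ∀ q, ‖q - γ s‖ < ρ → ‖v q - v (γ s)‖ ≤ L * ‖q - γ s‖)
    (h0 : ‖γ' 0 - γ 0‖ * Real.exp L < ρ) :
    ∀ s ∈ Icc (0 : ℝ) 1, ‖γ' s - γ s‖ < ρ := by
  set δ := ‖γ' 0 - γ 0‖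
  have hd : ∀ s ∈ Icc (0 : ℝ) 1,
      HasDerivWithinAt (fun s => γ' s - γ s) (v (γ' s) - v (γ s)) (Icc 0 1) s :=
    fun s hs => (hγ' s hs).sub (hγ s hs)
  have hc : ContinuousOn (fun s => γ' s - γ s) (Icc 0 1) :=
    fun s hs => (hd s hs).continuousWithinAt
  have hlt : ∀ s ∈ Icc (0 : ℝ) 1, δ * Real.exp (L * s) < ρ := fun s hs =>
    lt_of_le_of_lt (mul_le_mul_of_nonneg_left (Real.exp_le_exp.2
      (mul_le_of_le_one_right hL hs.2)) (norm_nonneg _)) h0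
  -- Continuous induction: the Gronwall bound is strictly below `ρ`, so by continuity the curve
  -- stays in the tube a little longer, and there the Lipschitz estimate extends the bound.
  have hsub : Icc (0 : ℝ) 1 ⊆ {s | ‖γ' s - γ s‖ ≤ δ * Real.exp (L * s)} := by
    refine IsClosed.Icc_subset_of_forall_exists_gt ?_ (by simp [δ]) ?_
    · rw [inter_comm]
      exact isClosed_Icc.isClosed_le hc.norm (by fun_prop)
    · rintro s ⟨hs1, hs2⟩ r (hr : s < r)
      have hsI : s ∈ Icc (0 : ℝ) 1 := Ico_subset_Icc_self hs2
      have hnear : ∀ᶠ u in 𝓝[≥] s, ‖γ' u - γ u‖ < ρ := by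
        have : ContinuousWithinAt (fun s => ‖γ' s - γ s‖) (Ici s) s :=
          (hc.norm s hsI).mono_of_mem_nhdsWithin (Icc_mem_nhdsGE_of_mem hs2)
        exact this.eventually (gt_mem_nhds (lt_of_le_of_lt hs1 (hlt s hsI)))
      obtain ⟨b, hb, hbs⟩ := (mem_nhdsGE_iff_exists_Icc_subset).1 hnear
      set c := min b (min 1 r)
      have hsc : s < c := lt_min hb (lt_min hs2.2 hr)
      have hcb : c ≤ b := min_le_left _ _
      have hc1 : c ≤ 1 := (min_le_right _ _).trans (min_le_left _ _)
      have hcr : c ≤ r := (min_le_right _ _).trans (min_le_right _ _)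
      have hI : Icc s c ⊆ Icc 0 1 := Icc_subset_Icc hs2.1 hc1
      have hgr := norm_le_gronwallBound_of_norm_deriv_right_le (hc.mono hI)
        (fun u hu => hasDerivWithinAt_Ici_of_Icc (hd u (hI (Ico_subset_Icc_self hu)))
          ⟨hs2.1.trans hu.1, hu.2.trans_le hc1⟩) hs1
        (K := L) (ε := 0) (fun u hu => by
          rw [add_zero]
          exact hv u (hI (Ico_subset_Icc_self hu)) _ (hbs ⟨hu.1, hu.2.le.trans hcb⟩))
        c ⟨hsc.le, le_rfl⟩
      refine ⟨c, ?_, hsc, hcr⟩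
      rw [gronwallBound_ε0, mul_assoc, ← Real.exp_add] at hgr
      change ‖γ' c - γ c‖ ≤ δ * Real.exp (L * c)
      convert hgr using 3
      ring
  exact fun s hs => (hsub hs).trans_lt (hlt s hs)

/-- If `dF(N)` is locally a Lipschitz function of `F`, then the flow of `N` preserves the level sets
of `F`. -/
lemma flowPreservesLevelSets_of_fderiv_apply {n : ℕ} {F φ : Space n → ℝ} {W : Set (Space n)}
    {N : Space n → Space n} (hW : IsOpen W) (hN : ContDiffOn ℝ 1 N W)
    (hF : DifferentiableOn ℝ F W) (hφ : ∀ x ∈ W, fderiv ℝ F x (N x) = φ x)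
    (hφF : ∀ p ∈ W, ∃ L : ℝ, 0 ≤ L ∧
      ∀ᶠ q in 𝓝 p ×ˢ 𝓝 p, |φ q.1 - φ q.2| ≤ L * |F q.1 - F q.2|) :
    FlowPreservesLevelSets F W N := by
  intro t x y hxy
  obtain ⟨γ, rfl, rfl, hγW, hγ⟩ := hxy.exists_curve
  have hγc : ContinuousOn γ (Icc 0 1) := fun s hs => (hγ s hs).continuousWithinAt
  have hK : IsCompact (γ '' Icc 0 1) := isCompact_Icc.image_of_continuousOn hγc
  have hKW : γ '' Icc 0 1 ⊆ W := by
    rintro _ ⟨s, hs, rfl⟩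
    exact hγW s hs
  obtain ⟨L, hL, ρ, hρ, HL⟩ := exists_uniform_le_mul_of_isCompact hK
    (f := fun q => ‖N q.1 - N q.2‖) (g := fun q => ‖q.1 - q.2‖) (fun _ => norm_nonneg _)
    (fun p hp => by
      obtain ⟨K, s, hs, hlip⟩ :=
        (hN.contDiffAt (hW.mem_nhds (hKW hp))).exists_lipschitzOnWith
      refine ⟨K, K.2, ?_⟩
      filter_upwards [prod_mem_prod hs hs] with q hq
      simpa [dist_eq_norm] using hlip.dist_le_mul _ hq.1 _ hq.2)
  obtain ⟨M, hM, ρ', hρ', HM⟩ := exists_uniform_le_mul_of_isCompact hK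
    (f := fun q => |φ q.1 - φ q.2|) (g := fun q => |F q.1 - F q.2|) (fun _ => abs_nonneg _)
    (fun p hp => hφF p (hKW hp))
  have hmin : 0 < min ρ ρ' := lt_min hρ hρ'
  have hclose : ∀ᶠ x' in 𝓝 (γ 0), ‖x' - γ 0‖ * Real.exp (|t| * L) < min ρ ρ' := by
    have : ContinuousAt (fun x' => ‖x' - γ 0‖ * Real.exp (|t| * L)) (γ 0) := by fun_prop
    exact this.eventually (gt_mem_nhds (by simpa using hmin))
  filter_upwards [hclose] with x' hx' hFx y' hy'
  obtain ⟨γ', rfl, rfl, hγW', hγ'⟩ := hy'.exists_curve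
  have htube := norm_sub_le_of_integralCurves (v := fun p => t • N p)
    (mul_nonneg (abs_nonneg t) hL) hγ hγ' (fun s hs q hq => by
      rw [← smul_sub, norm_smul, Real.norm_eq_abs, mul_assoc]
      exact mul_le_mul_of_nonneg_left (HL _ (mem_image_of_mem _ hs) _
        (by rw [dist_eq_norm]; exact hq.trans_le (min_le_left _ _))) (abs_nonneg _)) hx'
  have hd : ∀ s ∈ Icc (0 : ℝ) 1, HasDerivWithinAt (fun s => F (γ' s) - F (γ s))
      (t * (φ (γ' s) - φ (γ s))) (Icc 0 1) s := by
    have aux : ∀ c : ℝ → Space n, (∀ s ∈ Icc (0 : ℝ) 1, c s ∈ W) →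
        (∀ s ∈ Icc (0 : ℝ) 1, HasDerivWithinAt c (t • N (c s)) (Icc 0 1) s) →
        ∀ s ∈ Icc (0 : ℝ) 1, HasDerivWithinAt (fun s => F (c s)) (t * φ (c s)) (Icc 0 1) s := by
      intro c hcW hc s hs
      have h1 := ((hF.differentiableAt (hW.mem_nhds (hcW s hs))).hasFDerivAt).comp_hasDerivWithinAt
        s (hc s hs)
      rwa [map_smul, hφ _ (hcW s hs), smul_eq_mul] at h1
    intro s hs
    have := (aux γ' hγW' hγ' s hs).sub (aux γ hγW hγ s hs)
    rwa [← mul_sub] at this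
  -- The difference `u = F ∘ γ' - F ∘ γ` satisfies `|u'| ≤ |t| M |u|` and `u 0 = 0`, hence vanishes.
  have hzero := eq_zero_of_abs_deriv_le_mul_abs_self_of_eq_zero_right (K := |t| * M)
    (fun s hs => (hd s hs).continuousWithinAt)
    (fun s hs => hasDerivWithinAt_Ici_of_Icc (hd s (Ico_subset_Icc_self hs)) hs)
    (by simp [hFx]) (fun s hs => by
      have hs' := Ico_subset_Icc_self hs
      rw [norm_mul, mul_assoc]
      exact mul_le_mul_of_nonneg_left (HM _ (mem_image_of_mem _ hs') _
        (by rw [dist_eq_norm]; exact (htube s hs').trans_le (min_le_right _ _))) (abs_nonneg _))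
    1 ⟨zero_le_one, le_rfl⟩
  linarith

/-- If the flow of `N` preserves the level sets of `F`, then `dF(N)` is locally constant along the
level sets of `F`. -/
lemma FlowPreservesLevelSets.fderiv_apply_eq {n : ℕ} {F : Space n → ℝ} {W : Set (Space n)}
    {N : Space n → Space n} (h : FlowPreservesLevelSets F W N) (hW : IsOpen W)
    (hN : ContDiffOn ℝ 1 N W) (hF : ContDiffOn ℝ 1 F W) {p : Space n} (hp : p ∈ W)
    (hFp : fderiv ℝ F p ≠ 0) :
    ∀ᶠ x in 𝓝 p, F x = F p → fderiv ℝ F x (N x) = fderiv ℝ F p (N p) := by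
  obtain ⟨ε, hε, a, r, L, K, hr, hpl⟩ := IsPicardLindelof.of_contDiffAt_one
    (hN.contDiffAt (hW.mem_nhds hp))
  obtain ⟨α, hα, hαc⟩ :=
    (hpl 0).exists_forall_mem_closedBall_eq_hasDerivWithinAt_continuousOn
  have hp0 : ((p, 0) : Space n × ℝ) ∈ Metric.closedBall p r ×ˢ Icc (0 - ε) (0 + ε) :=
    ⟨Metric.mem_closedBall_self r.2, by constructor <;> linarith⟩
  have hnhds : Metric.closedBall p r ×ˢ Icc (0 - ε) (0 + ε) ∈ 𝓝 ((p, 0) : Space n × ℝ) :=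
    prod_mem_nhds (Metric.closedBall_mem_nhds _ hr) (Icc_mem_nhds (by linarith) (by linarith))
  have hαp : α (p, 0) = p := (hα p hp0.1).1
  have hWα : ∀ᶠ q in 𝓝 ((p, 0) : Space n × ℝ), α q ∈ W :=
    (hαc.continuousAt hnhds).eventually (by rw [hαp]; exact hW.mem_nhds hp)
  obtain ⟨η, hη, hηW⟩ := Metric.eventually_nhds_iff_ball.1 (hWα.and hnhds)
  have hV : Metric.ball p η ∈ 𝓝 p := Metric.ball_mem_nhds _ hη
  have hmem : ∀ x ∈ Metric.ball p η, ∀ s : ℝ, |s| < η → ((x, s) : Space n × ℝ) ∈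
      Metric.ball ((p, 0) : Space n × ℝ) η := by
    intro x hx s hs
    rw [← ball_prod_same]
    exact ⟨hx, by simpa using hs⟩
  have hball : ∀ x ∈ Metric.ball p η, x ∈ Metric.closedBall p r := fun x hx =>
    (hηW _ (hmem x hx 0 (by simpa using hη))).2.1
  have huIcc : ∀ t s : ℝ, |t| < η → s ∈ uIcc 0 t → |s| < η := fun t s ht hs =>
    (by simpa using abs_sub_left_of_mem_uIcc hs : |s| ≤ |t|).trans_lt ht
  have hflow : ∀ x ∈ Metric.ball p η, ∀ t : ℝ, |t| < η → FlowsTo W N t x (α (x, t)) := by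
    intro x hx t ht
    refine ⟨fun s => α (x, s), (hα x (hball x hx)).1, rfl,
      fun s hs => (hηW _ (hmem x hx s (huIcc t s ht hs))).1, fun s hs => ?_⟩
    have hsub : uIcc 0 t ⊆ Icc (0 - ε) (0 + ε) := fun u hu =>
      (hηW _ (hmem x hx u (huIcc t u ht hu))).2.2
    exact ((hα x (hball x hx)).2 s (hsub hs)).mono hsub
  -- `V'` is fixed before the function `g`, so the same neighbourhood serves every `F ∘ φ_t` with
  -- `|t| < η`; this uniformity is what allows differentiation in `t`.
  obtain ⟨V', hV', hconst⟩ := exists_mem_nhds_forall_eq_of_locallyConstant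
    (hF.contDiffAt (hW.mem_nhds hp)) hFp hV
  have hderiv : ∀ x ∈ Metric.ball p η,
      HasDerivAt (fun t => F (α (x, t))) (fderiv ℝ F x (N x)) 0 := by
    intro x hx
    have h0 := (hα x (hball x hx)).1
    have hxW : x ∈ W := by
      have := (hηW _ (hmem x hx 0 (by simpa using hη))).1
      rwa [h0] at this
    have h1 : HasDerivAt (fun t => α (x, t)) (N (α (x, 0))) 0 :=
      ((hα x (hball x hx)).2 0 (by constructor <;> linarith)).hasDerivAt
        (Icc_mem_nhds (by linarith) (by linarith))
    rw [h0] at h1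
    have h2 : HasFDerivAt F (fderiv ℝ F x) (α (x, 0)) := by
      rw [h0]
      exact ((hF.contDiffAt (hW.mem_nhds hxW)).differentiableAt (by simp)).hasFDerivAt
    exact h2.comp_hasDerivAt (0 : ℝ) h1
  filter_upwards [hV, hV'] with x hx hx' hFx
  refine (hderiv x hx).unique ((hderiv p (Metric.mem_ball_self hη)).congr_of_eventuallyEq ?_)
  filter_upwards [Metric.ball_mem_nhds (0 : ℝ) hη] with t ht
  have ht' : |t| < η := by simpa using ht
  refine hconst x hx' p (mem_of_mem_nhds hV') hFx (fun z => F (α (z, t))) fun y hy => ?_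
  filter_upwards [h t y _ (hflow y hy t ht'), Metric.isOpen_ball.mem_nhds hy] with y' h1 h2 h3
  exact h1 h3 _ (hflow y' h2 t ht')

end Flow

end LevelSetAffine

namespace LevelSetAffine

/-! ### Smoothness of matrix operations and Jacobi's formula. -/

section MatrixCalculus

variable {E ι : Type*} [NormedAddCommGroup E] [NormedSpace ℝ E] [Fintype ι] [DecidableEq ι]

lemma contDiffAt_det {k : ℕ∞ω} {A : E → Matrix ι ι ℝ} {x : E}
    (hA : ∀ i j, ContDiffAt ℝ k (fun y => A y i j) x) :
    ContDiffAt ℝ k (fun y => (A y).det) x := by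
  simp only [Matrix.det_apply']
  exact ContDiffAt.sum fun σ _ => contDiffAt_const.mul (contDiffAt_prod fun i _ => hA _ _)

lemma contDiffAt_adjugate {k : ℕ∞ω} {A : E → Matrix ι ι ℝ} {x : E}
    (hA : ∀ i j, ContDiffAt ℝ k (fun y => A y i j) x) (i j : ι) :
    ContDiffAt ℝ k (fun y => (A y).adjugate i j) x := by
  simp only [Matrix.adjugate_apply]
  refine contDiffAt_det fun a b => ?_
  simp only [Matrix.updateRow_apply]
  split_ifs
  · exact contDiffAt_const
  · exact hA a b

lemma contDiffAt_matrix_inv {k : ℕ∞ω} {A : E → Matrix ι ι ℝ} {x : E}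
    (hA : ∀ i j, ContDiffAt ℝ k (fun y => A y i j) x) (hx : (A x).det ≠ 0) (i j : ι) :
    ContDiffAt ℝ k (fun y => (A y)⁻¹ i j) x := by
  simp only [Matrix.inv_def, Matrix.smul_apply, smul_eq_mul, Ring.inverse_eq_inv']
  exact ((contDiffAt_det hA).inv hx).mul (contDiffAt_adjugate hA i j)

/-- The derivative of the determinant at the identity is the trace. -/
lemma hasFDerivAt_det_one : ∃ d : (ι → ι → ℝ) →L[ℝ] ℝ,
    HasFDerivAt (fun M : ι → ι → ℝ => (Matrix.of M).det) d (fun i j => (1 : Matrix ι ι ℝ) i j) ∧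
      ∀ M : ι → ι → ℝ, d M = ∑ i, M i i := by
  have hd : DifferentiableAt ℝ (fun M : ι → ι → ℝ => (Matrix.of M).det)
      (fun i j => (1 : Matrix ι ι ℝ) i j) := by
    refine (contDiffAt_det (k := 1) fun i j => ?_).differentiableAt (by simp)
    exact (ContDiff.contDiffAt (by simp only [Matrix.of_apply]; fun_prop))
  refine ⟨_, hd.hasFDerivAt, fun M => ?_⟩
  have h1 : HasDerivAt (fun t : ℝ => (fun i j => (1 : Matrix ι ι ℝ) i j) + t • M) M 0 := by
    simpa using ((hasDerivAt_id (0 : ℝ)).smul_const M).const_add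
      (fun i j => (1 : Matrix ι ι ℝ) i j)
  have h2 : HasDerivAt (fun t : ℝ => (Matrix.of ((fun i j => (1 : Matrix ι ι ℝ) i j) + t • M)).det)
      (fderiv ℝ (fun M : ι → ι → ℝ => (Matrix.of M).det)
        (fun i j => (1 : Matrix ι ι ℝ) i j) M) 0 := by
    have h3 := hd.hasFDerivAt
    rw [show (fun i j => (1 : Matrix ι ι ℝ) i j) =
      (fun i j => (1 : Matrix ι ι ℝ) i j) + (0 : ℝ) • M by simp] at h3
    have := h3.comp_hasDerivAt (0 : ℝ) h1
    simpa [Function.comp_def] using this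
  have h4 : HasDerivAt (fun t : ℝ => (Matrix.of ((fun i j => (1 : Matrix ι ι ℝ) i j) + t • M)).det)
      (Matrix.trace (Matrix.of M)) 0 := by
    -- `det (1 + t M)` is a polynomial `1 + t tr M + t² P(t)`, so its derivative at `0` can be read
    -- off.
    set P := (Matrix.det (1 + (Polynomial.X : Polynomial ℝ) •
      (Matrix.of M).map Polynomial.C)).divX.divX
    have h5 : (fun t : ℝ => (Matrix.of ((fun i j => (1 : Matrix ι ι ℝ) i j) + t • M)).det) =
        fun t => 1 + Matrix.trace (Matrix.of M) * t + P.eval t * t ^ 2 := by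
      funext t
      exact Matrix.det_one_add_smul t (Matrix.of M)
    rw [h5]
    have h6 := (((hasDerivAt_id (0 : ℝ)).const_mul (Matrix.trace (Matrix.of M))).const_add 1).add
      ((P.hasDerivAt 0).mul ((hasDerivAt_id (0 : ℝ)).pow 2))
    refine h6.congr_deriv ?_
    simp
  exact h2.unique h4

/-- Jacobi's formula. -/
lemma fderiv_det_apply {A : E → Matrix ι ι ℝ} {x : E}
    (hA : ∀ i j, DifferentiableAt ℝ (fun y => A y i j) x) (hx : (A x).det ≠ 0) (v : E) :
    fderiv ℝ (fun y => (A y).det) x v =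
      (A x).det * ∑ i, ∑ j, (A x)⁻¹ i j * fderiv ℝ (fun y => A y j i) x v := by
  obtain ⟨d, hd, hdM⟩ := hasFDerivAt_det_one (ι := ι)
  -- Dividing by `A x` moves the base point to the identity.
  set R : E → ι → ι → ℝ := fun y i j => ((A x)⁻¹ * A y) i j
  have hR : HasFDerivAt R (ContinuousLinearMap.pi fun i => ContinuousLinearMap.pi fun j =>
      ∑ k, (A x)⁻¹ i k • fderiv ℝ (fun y => A y k j) x) x := by
    refine hasFDerivAt_pi.2 fun i => hasFDerivAt_pi.2 fun j => ?_
    simp only [Matrix.mul_apply]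
    exact HasFDerivAt.fun_sum fun k _ => (hA k j).hasFDerivAt.const_mul _
  have hRx : R x = fun i j => (1 : Matrix ι ι ℝ) i j := by
    funext i j
    simp only [R, Matrix.nonsing_inv_mul _ (isUnit_iff_ne_zero.2 hx)]
  have hdet : (fun y => (A y).det) = fun y => (A x).det * (Matrix.of (R y)).det := by
    funext y
    rw [show Matrix.of (R y) = (A x)⁻¹ * A y from rfl, ← Matrix.det_mul, ← mul_assoc,
      Matrix.mul_nonsing_inv _ (isUnit_iff_ne_zero.2 hx), one_mul]
  rw [← hRx] at hd
  have h := (hd.comp x hR).const_mul (A x).det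
  rw [hdet]
  refine (congrArg (fun m : E →L[ℝ] ℝ => m v) h.fderiv).trans ?_
  simp [hdM]

end MatrixCalculus

/-! ### The Hessian metric, index raising and their derivatives. -/

section Hessian

variable {n : ℕ} {F : Space n → ℝ} {x : Space n}

/-- The Hessian as a bilinear form. -/
noncomputable abbrev hessForm (F : Space n → ℝ) (x : Space n) :
    Space n →L[ℝ] Space n →L[ℝ] ℝ :=
  fderiv ℝ (fderiv ℝ F) x

lemma sum_smul_basisVec (v : Space n) : ∑ i, v i • basisVec i = v :=
  (pi_eq_sum_univ' v).symm

lemma apply_eq_sum_basisVec {M : Type*} [AddCommGroup M] [Module ℝ M] [TopologicalSpace M]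
    (l : Space n →L[ℝ] M) (v : Space n) : l v = ∑ i, v i • l (basisVec i) := by
  conv_lhs => rw [← sum_smul_basisVec v]
  simp

lemma two_le_infty : (2 : ℕ∞ω) ≤ ∞ :=
  WithTop.coe_le_coe.2 (le_top : (2 : ℕ∞) ≤ ⊤)

lemma contDiffAt_fderiv (hF : ContDiffAt ℝ ∞ F x) : ContDiffAt ℝ ∞ (fderiv ℝ F) x :=
  hF.fderiv_right (by simp)

lemma contDiffAt_pd (hF : ContDiffAt ℝ ∞ F x) (i : Fin (n + 1)) : ContDiffAt ℝ ∞ (pd i F) x :=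
  (contDiffAt_fderiv hF).clm_apply contDiffAt_const

lemma fderiv_pd_apply (hF : ContDiffAt ℝ ∞ F x) (i : Fin (n + 1)) (v : Space n) :
    fderiv ℝ (pd i F) x v = hessForm F x v (basisVec i) := by
  have h := ((contDiffAt_fderiv hF).differentiableAt (by simp)).hasFDerivAt.clm_apply
    (hasFDerivAt_const (basisVec i) x)
  refine (congrArg (fun m : Space n →L[ℝ] ℝ => m v) h.fderiv).trans ?_
  simp

lemma hess_apply (hF : ContDiffAt ℝ ∞ F x) (i j : Fin (n + 1)) :
    hess F x i j = hessForm F x (basisVec i) (basisVec j) :=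
  fderiv_pd_apply hF j _

lemma hessForm_comm (hF : ContDiffAt ℝ ∞ F x) (u v : Space n) :
    hessForm F x u v = hessForm F x v u :=
  (hF.of_le (m := 2) two_le_infty).isSymmSndFDerivAt
    (by simp [minSmoothness_of_isRCLikeNormedField]) u v

lemma third_comm (hF : ContDiffAt ℝ ∞ F x) (i j k : Fin (n + 1)) :
    third F x i j k = third F x j i k := by
  have h := contDiffAt_pd hF k
  change fderiv ℝ (pd j (pd k F)) x _ = fderiv ℝ (pd i (pd k F)) x _
  rw [fderiv_pd_apply h, fderiv_pd_apply h, hessForm_comm h]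

lemma hess_comm (hF : ContDiffAt ℝ ∞ F x) (i j : Fin (n + 1)) : hess F x i j = hess F x j i := by
  rw [hess_apply hF, hess_apply hF, hessForm_comm hF]

lemma fderiv_apply_eq_dotProduct (v : Space n) : fderiv ℝ F x v = v ⬝ᵥ grad F x :=
  apply_eq_sum_basisVec _ v

lemma hessForm_apply (hF : ContDiffAt ℝ ∞ F x) (u v : Space n) :
    hessForm F x u v = u ⬝ᵥ (hess F x).mulVec v := by
  rw [apply_eq_sum_basisVec (hessForm F x) u, sum_apply]
  refine Finset.sum_congr rfl fun i _ => ?_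
  rw [smul_apply, apply_eq_sum_basisVec, smul_eq_mul, Matrix.mulVec]
  congr 1
  refine Finset.sum_congr rfl fun j _ => ?_
  dsimp only
  rw [hess_apply hF, smul_eq_mul, mul_comm]

/-- The vector field dual to a one-form with respect to the Hessian. -/
noncomputable def sharp (F : Space n → ℝ) (x : Space n) (α : Space n →L[ℝ] ℝ) : Space n :=
  (hess F x)⁻¹.mulVec fun i => α (basisVec i)

lemma hessForm_sharp (hF : ContDiffAt ℝ ∞ F x) (hx : (hess F x).det ≠ 0)
    (α : Space n →L[ℝ] ℝ) (v : Space n) : hessForm F x (sharp F x α) v = α v := by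
  rw [hessForm_comm hF, hessForm_apply hF, sharp, Matrix.mulVec_mulVec,
    Matrix.mul_nonsing_inv _ (isUnit_iff_ne_zero.2 hx), Matrix.one_mulVec, apply_eq_sum_basisVec α v]
  rfl

lemma hessForm_hessGrad (hF : ContDiffAt ℝ ∞ F x) (hx : (hess F x).det ≠ 0) (v : Space n) :
    hessForm F x (hessGrad F x) v = fderiv ℝ F x v :=
  hessForm_sharp hF hx _ v

lemma fderiv_sharp (hF : ContDiffAt ℝ ∞ F x) (hx : (hess F x).det ≠ 0)
    (α : Space n →L[ℝ] ℝ) : fderiv ℝ F x (sharp F x α) = α (hessGrad F x) := by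
  rw [← hessForm_hessGrad hF hx, hessForm_comm hF, hessForm_sharp hF hx]

lemma eq_of_hessForm_eq (hF : ContDiffAt ℝ ∞ F x) (hx : (hess F x).det ≠ 0) {u v : Space n}
    (h : ∀ w, hessForm F x u w = hessForm F x v w) : u = v := by
  have h1 : (hess F x).mulVec u = (hess F x).mulVec v := by
    refine dotProduct_eq _ _ fun w => ?_
    rw [dotProduct_comm, dotProduct_comm _ w]
    rw [← hessForm_apply hF, ← hessForm_apply hF, hessForm_comm hF, h, hessForm_comm hF]
  have h2 := congrArg (hess F x)⁻¹.mulVec h1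
  simpa [Matrix.mulVec_mulVec, Matrix.nonsing_inv_mul _ (isUnit_iff_ne_zero.2 hx)] using h2

variable {Ψ : VolForm n}

lemma det_hess_ne_zero (hH : hessDet Ψ F x ≠ 0) : (hess F x).det ≠ 0 := by
  intro h
  exact hH (by simp [hessDet, h])

/-- The adjugate is the determinant times the inverse. This removes the adjugate from the later
algebra and shows that `F^♯` is transverse where `U ≠ 0`. -/
lemma uFun_eq (hH : hessDet Ψ F x ≠ 0) :
    uFun Ψ F x = hessDet Ψ F x * fderiv ℝ F x (hessGrad F x) := by
  have hx := det_hess_ne_zero hH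
  have hadj : (hess F x).adjugate = (hess F x).det • (hess F x)⁻¹ := by
    rw [Matrix.inv_def, smul_smul, Ring.mul_inverse_cancel _ (isUnit_iff_ne_zero.2 hx), one_smul]
  rw [fderiv_apply_eq_dotProduct]
  simp only [uFun, adjHess, hadj, dotProduct, hessGrad, hessDet, Matrix.smul_apply, smul_eq_mul,
    Finset.mul_sum, Finset.sum_mul]
  refine Finset.sum_congr rfl fun i _ => Finset.sum_congr rfl fun j _ => ?_
  ring

lemma contDiffAt_grad (hF : ContDiffAt ℝ ∞ F x) (i : Fin (n + 1)) :
    ContDiffAt ℝ ∞ (fun y => grad F y i) x := contDiffAt_pd hF i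

lemma contDiffAt_hess (hF : ContDiffAt ℝ ∞ F x) (i j : Fin (n + 1)) :
    ContDiffAt ℝ ∞ (fun y => hess F y i j) x := contDiffAt_pd (contDiffAt_pd hF j) i

lemma contDiffAt_hessDet (hF : ContDiffAt ℝ ∞ F x) : ContDiffAt ℝ ∞ (hessDet Ψ F) x :=
  (contDiffAt_det (contDiffAt_hess hF)).div_const _

lemma contDiffAt_uFun (hF : ContDiffAt ℝ ∞ F x) : ContDiffAt ℝ ∞ (uFun Ψ F) x := by
  refine ContDiffAt.sum fun i _ => ContDiffAt.sum fun j _ => ?_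
  refine (ContDiffAt.mul ?_ (contDiffAt_grad hF i)).mul (contDiffAt_grad hF j)
  exact contDiffAt_const.mul (contDiffAt_adjugate (contDiffAt_hess hF) i j)

lemma contDiffAt_sharp (hF : ContDiffAt ℝ ∞ F x) (hx : (hess F x).det ≠ 0)
    {α : Space n → Space n →L[ℝ] ℝ} (hα : ContDiffAt ℝ ∞ α x) :
    ContDiffAt ℝ ∞ (fun y => sharp F y (α y)) x := by
  refine contDiffAt_pi.2 fun i => ?_
  simp only [sharp, Matrix.mulVec, dotProduct]
  exact ContDiffAt.sum fun j _ => (contDiffAt_matrix_inv (contDiffAt_hess hF) hx i j).mul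
    (hα.clm_apply contDiffAt_const)

lemma contDiffAt_hessGrad (hF : ContDiffAt ℝ ∞ F x) (hx : (hess F x).det ≠ 0) :
    ContDiffAt ℝ ∞ (hessGrad F) x :=
  contDiffAt_sharp hF hx (contDiffAt_fderiv hF)

lemma contDiffAt_muForm (hF : ContDiffAt ℝ ∞ F x) (hU : uFun Ψ F x ≠ 0) :
    ContDiffAt ℝ ∞ (muForm Ψ F) x :=
  (contDiffAt_const.mul ((contDiffAt_uFun hF).inv hU)).smul
    (contDiffAt_fderiv (contDiffAt_uFun hF))

/-- The derivative of `log |H(F)|`, by Jacobi's formula. -/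
lemma fderiv_hessDet_apply (hF : ContDiffAt ℝ ∞ F x) (hH : hessDet Ψ F x ≠ 0) (v : Space n) :
    (hessDet Ψ F x)⁻¹ * fderiv ℝ (hessDet Ψ F) x v =
      ∑ i, ∑ p, ∑ q, third F x i p q * (hess F x)⁻¹ q i * v p := by
  have hx := det_hess_ne_zero hH
  have hd : ∀ i j, DifferentiableAt ℝ (fun y => hess F y i j) x :=
    fun i j => (contDiffAt_hess hF i j).differentiableAt (by simp)
  have hΨ : Ψ basisVec ≠ 0 := by
    intro h
    exact hH (by simp [hessDet, h])
  have h1 : fderiv ℝ (hessDet Ψ F) x v = hessDet Ψ F x * ∑ i, ∑ j, (hess F x)⁻¹ i j *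
      fderiv ℝ (fun y => hess F y j i) x v := by
    have h2 : hessDet Ψ F = fun y => ((Ψ basisVec) ^ 2)⁻¹ • (hess F y).det := by
      funext y
      simp [hessDet, div_eq_inv_mul]
    rw [h2, fderiv_fun_const_smul ((contDiffAt_det (contDiffAt_hess hF)).differentiableAt (by simp)),
      smul_apply, fderiv_det_apply hd hx]
    simp only [smul_eq_mul]
    ring
  rw [h1, inv_mul_cancel_left₀ hH, Finset.sum_comm]
  refine Finset.sum_congr rfl fun i _ => ?_
  rw [Finset.sum_comm]
  refine Finset.sum_congr rfl fun q _ => ?_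
  rw [apply_eq_sum_basisVec, Finset.mul_sum]
  refine Finset.sum_congr rfl fun p _ => ?_
  rw [third_comm hF]
  change _ * (_ • third F x p i q) = _
  rw [smul_eq_mul]
  ring

/-- The covariant derivative of `F^i`. -/
lemma fderiv_hessGrad_apply (hFe : ∀ᶠ y in 𝓝 x, ContDiffAt ℝ ∞ F y) (hx : (hess F x).det ≠ 0)
    (i j : Fin (n + 1)) :
    fderiv ℝ (hessGrad F) x (basisVec i) j = (if i = j then 1 else 0)
      - ∑ p, ∑ q, third F x i p q * (hess F x)⁻¹ q j * hessGrad F x p := by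
  have hF := hFe.self_of_nhds
  have hev : ∀ᶠ y in 𝓝 x, (hess F y).det ≠ 0 :=
    (contDiffAt_det (k := ∞) (contDiffAt_hess hF)).continuousAt.eventually_ne hx
  have hGd : DifferentiableAt ℝ (hessGrad F) x :=
    (contDiffAt_hessGrad hF hx).differentiableAt (by simp)
  -- Differentiate the identity `F_{pq} F^p = F_q`; contracting with the inverse Hessian afterwards
  -- isolates `D_i F^j`.
  have hrow : ∀ q, ∑ p, (third F x i p q * hessGrad F x p +
      hess F x p q * fderiv ℝ (hessGrad F) x (basisVec i) p) = hess F x i q := by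
    intro q
    have h1 : (fun y => ∑ p, hess F y p q * hessGrad F y p) =ᶠ[𝓝 x] pd q F := by
      filter_upwards [hev, hFe] with y hy hFy
      have hs : ∀ p, hess F y p q = hess F y q p := fun p => hess_comm hFy p q
      simp only [hs]
      have h2 : (hess F y).mulVec (hessGrad F y) = grad F y := by
        rw [show hessGrad F y = (hess F y)⁻¹.mulVec (grad F y) from rfl, Matrix.mulVec_mulVec,
          Matrix.mul_nonsing_inv _ (isUnit_iff_ne_zero.2 hy), Matrix.one_mulVec]
      exact congrFun h2 q
    have h3 : HasFDerivAt (fun y => ∑ p, hess F y p q * hessGrad F y p)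
        (∑ p, (hess F x p q • ((ContinuousLinearMap.proj p).comp (fderiv ℝ (hessGrad F) x)) +
          hessGrad F x p • fderiv ℝ (fun y => hess F y p q) x)) x := by
      refine HasFDerivAt.fun_sum fun p _ => HasFDerivAt.mul ?_ ?_
      · exact ((contDiffAt_hess hF p q).differentiableAt (by simp)).hasFDerivAt
      · exact hasFDerivAt_pi'.1 hGd.hasFDerivAt p
    have h4 := congrArg (fun m : Space n →L[ℝ] ℝ => m (basisVec i)) (h1.fderiv_eq.symm.trans h3.fderiv)
    change hess F x i q = _ at h4
    rw [h4]
    simp only [sum_apply, add_apply,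
      smul_apply, smul_eq_mul, ContinuousLinearMap.comp_apply]
    refine Finset.sum_congr rfl fun p _ => ?_
    change _ = _ + _ * third F x i p q
    rw [ContinuousLinearMap.proj_apply]
    ring
  have hinv : ∀ p, ∑ q, hess F x p q * (hess F x)⁻¹ q j = if p = j then 1 else 0 := by
    intro p
    rw [← Matrix.mul_apply, Matrix.mul_nonsing_inv _ (isUnit_iff_ne_zero.2 hx), Matrix.one_apply]
  have h5 : ∑ q, (∑ p, (third F x i p q * hessGrad F x p +
      hess F x p q * fderiv ℝ (hessGrad F) x (basisVec i) p)) * (hess F x)⁻¹ q j =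
      if i = j then 1 else 0 := by
    simp only [hrow, hinv]
  rw [← h5]
  simp only [Finset.sum_mul, add_mul, Finset.sum_add_distrib]
  rw [Finset.sum_comm (γ := Fin (n + 1)), Finset.sum_comm (γ := Fin (n + 1)) (f := fun q p =>
    hess F x p q * _ * _)]
  have h6 : ∀ p, ∑ q, hess F x p q * fderiv ℝ (hessGrad F) x (basisVec i) p * (hess F x)⁻¹ q j =
      fderiv ℝ (hessGrad F) x (basisVec i) p * if p = j then 1 else 0 := by
    intro p
    rw [← hinv p, Finset.mul_sum]
    exact Finset.sum_congr rfl fun q _ => by ring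
  simp only [h6, mul_ite, mul_one, mul_zero, Finset.sum_ite_eq', Finset.mem_univ, if_true]
  rw [eq_sub_iff_add_eq, add_comm]
  congr 1
  exact Finset.sum_congr rfl fun p _ => Finset.sum_congr rfl fun q _ => mul_right_comm _ _ _

end Hessian

end LevelSetAffine

namespace LevelSetAffine

variable {n : ℕ} {Ψ : VolForm n} {F : Space n → ℝ} {W : Set (Space n)} {x : Space n}

/-! ### The scalar factors built from `U` and `H`. -/

section Factor

/-- The function `|U(F)|^{1/(n+2)}`. -/
noncomputable def uPow (Ψ : VolForm n) (F : Space n → ℝ) (x : Space n) : ℝ :=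
  |uFun Ψ F x| ^ (1 / ((n : ℝ) + 2))

lemma uPow_pos (hU : uFun Ψ F x ≠ 0) : 0 < uPow Ψ F x :=
  Real.rpow_pos_of_pos (abs_pos.2 hU) _

lemma uPow_pow : uPow Ψ F x ^ (n + 2) = |uFun Ψ F x| := by
  have h := Real.rpow_inv_natCast_pow (abs_nonneg (uFun Ψ F x)) (n := n + 2) (by simp)
  rw [uPow, one_div]
  push_cast at h
  exact h

lemma conormal_eq : conormal Ψ F x = (-(uPow Ψ F x)⁻¹) • fderiv ℝ F x := by
  rw [conormal, uPow, Real.rpow_neg (abs_nonneg _)]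

lemma sign_mul_inv_abs (a : ℝ) : Real.sign a * |a|⁻¹ = a⁻¹ := by
  rcases lt_trichotomy a 0 with h | rfl | h
  · rw [Real.sign_of_neg h, abs_of_neg h, inv_neg]
    ring
  · simp
  · rw [Real.sign_of_pos h, abs_of_pos h, one_mul]

/-- Since `-(n+1)/(n+2) = 1/(n+2) - 1` and `sign(U) |U|⁻¹ = U⁻¹`, signs and absolute values survive
only inside `uPow`, and the remaining algebra is rational. -/
lemma normalFactor_eq (hU : uFun Ψ F x ≠ 0) :
    normalFactor Ψ F x = uPow Ψ F x * hessDet Ψ F x * (uFun Ψ F x)⁻¹ := by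
  have h2 : (n : ℝ) + 2 ≠ 0 := by positivity
  have h : |uFun Ψ F x| ^ (-(((n : ℝ) + 1) / ((n : ℝ) + 2))) = uPow Ψ F x * |uFun Ψ F x|⁻¹ := by
    rw [uPow, ← div_eq_mul_inv, ← Real.rpow_sub_one (abs_ne_zero.2 hU)]
    congr 1
    field_simp
    ring
  rw [normalFactor, h, ← sign_mul_inv_abs (uFun Ψ F x)]
  ring

lemma contDiffAt_uPow (hF : ContDiffAt ℝ ∞ F x) (hU : uFun Ψ F x ≠ 0) :
    ContDiffAt ℝ ∞ (uPow Ψ F) x :=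
  ((contDiffAt_abs hU).comp x (contDiffAt_uFun hF)).rpow_const_of_ne (abs_ne_zero.2 hU)

lemma fderiv_uPow (hF : ContDiffAt ℝ ∞ F x) (hU : uFun Ψ F x ≠ 0) :
    fderiv ℝ (uPow Ψ F) x = uPow Ψ F x • muForm Ψ F x := by
  have h1 := ((contDiffAt_uFun (Ψ := Ψ) hF).differentiableAt (by simp)).hasFDerivAt
  have h2 := ((hasDerivAt_abs hU).comp_hasFDerivAt x h1).rpow_const
    (p := 1 / ((n : ℝ) + 2)) (Or.inl (abs_ne_zero.2 hU))
  refine h2.fderiv.trans ?_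
  have h3 : ((SignType.sign (uFun Ψ F x) : SignType) : ℝ) * |uFun Ψ F x|⁻¹ = (uFun Ψ F x)⁻¹ := by
    rcases lt_or_gt_of_ne hU with h | h
    · rw [sign_neg h, abs_of_neg h, inv_neg]
      simp
    · rw [sign_pos h, abs_of_pos h]
      simp
  ext v
  simp only [muForm, smul_apply, smul_eq_mul, Function.comp_apply,
    Real.rpow_sub_one (abs_ne_zero.2 hU), ← h3]
  rw [uPow]
  ring

/-- The derivative of `sign(U) H |U|^{-(n+1)/(n+2)}`. -/
lemma fderiv_normalFactor_apply (hF : ∀ᶠ y in 𝓝 x, ContDiffAt ℝ ∞ F y)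
    (hH : hessDet Ψ F x ≠ 0) (hU : uFun Ψ F x ≠ 0) (v : Space n) :
    fderiv ℝ (normalFactor Ψ F) x v = normalFactor Ψ F x *
      ((hessDet Ψ F x)⁻¹ * fderiv ℝ (hessDet Ψ F) x v - ((n : ℝ) + 1) * muForm Ψ F x v) := by
  have hFx := hF.self_of_nhds
  have hev : normalFactor Ψ F =ᶠ[𝓝 x]
      fun y => uPow Ψ F y * hessDet Ψ F y * (uFun Ψ F y)⁻¹ := by
    filter_upwards [(contDiffAt_uFun hFx).continuousAt.eventually_ne hU] with y hy
    exact normalFactor_eq hy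
  have h1 := ((contDiffAt_uFun (Ψ := Ψ) hFx).differentiableAt (by simp)).hasFDerivAt
  have h2 := ((contDiffAt_hessDet (Ψ := Ψ) hFx).differentiableAt (by simp)).hasFDerivAt
  have h3 := ((contDiffAt_uPow (Ψ := Ψ) hFx hU).differentiableAt (by simp)).hasFDerivAt
  rw [fderiv_uPow hFx hU] at h3
  have h4 := (h3.mul h2).mul ((hasDerivAt_inv hU).comp_hasFDerivAt x h1)
  rw [hev.fderiv_eq]
  refine (congrArg (fun m : Space n →L[ℝ] ℝ => m v) h4.fderiv).trans ?_
  have h5 : (n : ℝ) + 2 ≠ 0 := by positivity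
  rw [normalFactor_eq hU]
  simp only [muForm, smul_apply, add_apply, smul_eq_mul]
  simp only [Pi.mul_apply, Function.comp_apply]
  field_simp
  ring

lemma contDiffAt_aFun (hF : ContDiffAt ℝ ∞ F x) (hH : hessDet Ψ F x ≠ 0)
    (hU : uFun Ψ F x ≠ 0) : ContDiffAt ℝ ∞ (aFun Ψ F) x :=
  contDiffAt_const.sub ((contDiffAt_muForm hF hU).clm_apply
    (contDiffAt_hessGrad hF (det_hess_ne_zero hH)))

lemma fderiv_hessGrad (hH : hessDet Ψ F x ≠ 0) :
    fderiv ℝ F x (hessGrad F x) = uFun Ψ F x * (hessDet Ψ F x)⁻¹ := by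
  rw [uFun_eq hH]
  field_simp

lemma fderiv_ne_zero (hH : hessDet Ψ F x ≠ 0) (hU : uFun Ψ F x ≠ 0) : fderiv ℝ F x ≠ 0 := by
  intro h
  rw [uFun_eq hH, h] at hU
  simp at hU

end Factor

/-! ### Volumes and Gram determinants of tangent frames. -/

section Frames

lemma finrank_tangent (h : fderiv ℝ F x ≠ 0) : Module.finrank ℝ (tangent F x) = n := by
  have h1 : (fderiv ℝ F x).toLinearMap ≠ 0 := fun h0 => h (ContinuousLinearMap.coe_injective h0)
  have h2 := Module.Dual.finrank_ker_add_one_of_ne_zero (f := (fderiv ℝ F x).toLinearMap) h1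
  simpa using h2

lemma volForm_eq_zero_of_mem_tangent (h : fderiv ℝ F x ≠ 0) (X : Fin (n + 1) → tangent F x) :
    Ψ (fun i => (X i : Space n)) = 0 := by
  refine Ψ.map_linearDependent _ fun hli => ?_
  have h1 : LinearIndependent ℝ X := LinearIndependent.of_comp (tangent F x).subtype hli
  have h2 := h1.fintype_card_le_finrank
  rw [finrank_tangent h, Fintype.card_fin] at h2
  omega

/-- The combination `dF(u) v - dF(v) u` is tangent, so `Ψ` vanishes on it together with `n` tangent
vectors. -/
lemma fderiv_mul_volForm_cons (h : fderiv ℝ F x ≠ 0) (u v : Space n) (X : Fin n → tangent F x) :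
    fderiv ℝ F x u * Ψ (Fin.cons v fun i => (X i : Space n)) =
      fderiv ℝ F x v * Ψ (Fin.cons u fun i => (X i : Space n)) := by
  let w : tangent F x := ⟨fderiv ℝ F x u • v - fderiv ℝ F x v • u, by
    simp [mul_comm]⟩
  have h1 := volForm_eq_zero_of_mem_tangent (Ψ := Ψ) h (Fin.cons w X)
  have h2 : (fun i => ((Fin.cons w X : Fin (n + 1) → tangent F x) i : Space n)) =
      Fin.cons (w : Space n) fun i => (X i : Space n) := by
    funext i
    refine Fin.cases rfl (fun i => rfl) i
  rw [h2] at h1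
  have h3 : Ψ.curryLeft (w : Space n) (fun i => (X i : Space n)) = 0 := h1
  rw [show (w : Space n) = fderiv ℝ F x u • v - fderiv ℝ F x v • u from rfl, map_sub, map_smul,
    map_smul] at h3
  exact sub_eq_zero.1 h3

lemma volForm_eq_mul_det (M : Fin (n + 1) → Space n) :
    Ψ M = Ψ basisVec * (Matrix.of M).det := by
  have hb : (⇑(Pi.basisFun ℝ (Fin (n + 1))) : Fin (n + 1) → Space n) = basisVec :=
    funext fun i => Pi.basisFun_apply ℝ _ i
  have h := Ψ.eq_smul_basis_det (Pi.basisFun ℝ (Fin (n + 1)))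
  rw [hb] at h
  conv_lhs => rw [h]
  rw [AlternatingMap.smul_apply, Pi.basisFun_det, smul_eq_mul]
  rfl

/-- The Gram matrix of the Hessian on tangent vectors. -/
noncomputable def gram (F : Space n → ℝ) (x : Space n) (X : Fin n → tangent F x) :
    Matrix (Fin n) (Fin n) ℝ :=
  Matrix.of fun i j => hessForm F x (X i) (X j)

/-- `F^♯` is `g`-orthogonal to the tangent space, so the Gram matrix of the frame `(F^♯, X)` is
block diagonal. Its determinant is also `det(M)² det(Hess F)`, where the rows of `M` are the frame.
-/
lemma volForm_cons_hessGrad_sq (hF : ContDiffAt ℝ ∞ F x) (hH : hessDet Ψ F x ≠ 0)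
    (X : Fin n → tangent F x) :
    (Ψ (Fin.cons (hessGrad F x) fun i => (X i : Space n))) ^ 2 * hessDet Ψ F x ^ 2 =
      uFun Ψ F x * (gram F x X).det := by
  have hx := det_hess_ne_zero hH
  have hΨ : Ψ basisVec ≠ 0 := by
    intro h
    exact hH (by simp [hessDet, h])
  set r : Fin (n + 1) → Space n := Fin.cons (hessGrad F x) fun i => (X i : Space n) with hr
  set M : Matrix (Fin (n + 1)) (Fin (n + 1)) ℝ := Matrix.of r
  have hgram : ∀ i j, (M * hess F x * M.transpose) i j = hessForm F x (r i) (r j) := by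
    intro i j
    rw [hessForm_apply hF, Matrix.mul_assoc, Matrix.mul_apply]
    simp only [dotProduct, Matrix.mulVec, Matrix.mul_apply, Matrix.transpose_apply, M,
      Matrix.of_apply]
  have hdet : (M * hess F x * M.transpose).det =
      fderiv ℝ F x (hessGrad F x) * (gram F x X).det := by
    rw [Matrix.det_succ_row_zero, Fin.sum_univ_succ]
    have h0 : ∀ j : Fin n, (M * hess F x * M.transpose) 0 j.succ = 0 := by
      intro j
      rw [hgram]
      simp only [hr, Fin.cons_zero, Fin.cons_succ]
      rw [hessForm_hessGrad hF hx]
      exact (X j).2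
    simp only [h0, mul_zero, zero_mul, Finset.sum_const_zero, add_zero]
    rw [hgram]
    simp only [hr, Fin.cons_zero, Fin.val_zero, pow_zero, one_mul]
    rw [hessForm_hessGrad hF hx]
    congr 2
    ext i j
    rw [Matrix.submatrix_apply, hgram]
    simp [hr, gram]
  rw [Matrix.det_mul, Matrix.det_mul, Matrix.det_transpose] at hdet
  rw [volForm_eq_mul_det, uFun_eq hH, mul_assoc, ← hdet]
  change (Ψ basisVec * M.det) ^ 2 * _ = _
  simp only [hessDet]
  field_simp

lemma volForm_cons_sq (hF : ContDiffAt ℝ ∞ F x) (hH : hessDet Ψ F x ≠ 0) (hU : uFun Ψ F x ≠ 0)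
    (v : Space n) (X : Fin n → tangent F x) :
    (Ψ (Fin.cons v fun i => (X i : Space n))) ^ 2 =
      fderiv ℝ F x v ^ 2 * |(gram F x X).det| * |uFun Ψ F x|⁻¹ := by
  have h1 := fderiv_mul_volForm_cons (Ψ := Ψ) (fderiv_ne_zero hH hU) (hessGrad F x) v X
  have h2 := volForm_cons_hessGrad_sq hF hH X
  rw [fderiv_hessGrad hH] at h1
  set a := Ψ (Fin.cons v fun i => (X i : Space n))
  set b := Ψ (Fin.cons (hessGrad F x) fun i => (X i : Space n))
  have h3 : b ^ 2 * hessDet Ψ F x ^ 2 = |uFun Ψ F x| * |(gram F x X).det| := by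
    rw [← abs_mul, ← h2, abs_of_nonneg (by positivity)]
  have h4 : |uFun Ψ F x| ^ 2 * a ^ 2 =
      fderiv ℝ F x v ^ 2 * (b ^ 2 * hessDet Ψ F x ^ 2) := by
    have h5 : uFun Ψ F x * a = fderiv ℝ F x v * b * hessDet Ψ F x := by
      field_simp at h1
      linarith
    rw [sq_abs, ← mul_pow, h5]
    ring
  have hU' : |uFun Ψ F x| ≠ 0 := abs_ne_zero.2 hU
  rw [h3] at h4
  field_simp
  have h6 : |uFun Ψ F x| * (a ^ 2 * |uFun Ψ F x|) =
      |uFun Ψ F x| * (fderiv ℝ F x v ^ 2 * |(gram F x X).det|) := by linarith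
  exact mul_left_cancel₀ hU' h6

/-- A tangent basis completed by the transverse vector `F^♯` is a basis of the whole space, on which
`Ψ` cannot vanish. -/
lemma exists_gram_det_ne_zero (hF : ContDiffAt ℝ ∞ F x) (hH : hessDet Ψ F x ≠ 0)
    (hU : uFun Ψ F x ≠ 0) : ∃ X : Fin n → tangent F x, (gram F x X).det ≠ 0 := by
  let b := Module.finBasisOfFinrankEq ℝ (tangent F x) (finrank_tangent (fderiv_ne_zero hH hU))
  refine ⟨b, fun h0 => ?_⟩
  have h1 := volForm_cons_hessGrad_sq hF hH b
  rw [h0, mul_zero] at h1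
  have h2 : Ψ (Fin.cons (hessGrad F x) fun i => (b i : Space n)) = 0 := by
    simpa [hH] using h1
  have hli : LinearIndependent ℝ
      (Fin.cons (hessGrad F x) fun i => (b i : Space n) : Fin (n + 1) → Space n) := by
    rw [linearIndependent_finCons]
    refine ⟨b.linearIndependent.map' (tangent F x).subtype (Submodule.ker_subtype _), fun hs => ?_⟩
    have h3 : hessGrad F x ∈ tangent F x := by
      refine (Submodule.span_le.2 ?_) hs
      rintro _ ⟨i, rfl⟩
      exact (b i).2
    have h4 : fderiv ℝ F x (hessGrad F x) = 0 := h3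
    rw [fderiv_hessGrad hH] at h4
    exact mul_ne_zero hU (inv_ne_zero hH) h4
  have hΨ : Ψ ≠ 0 := by
    rintro rfl
    exact hH (by simp [hessDet])
  let B := basisOfLinearIndependentOfCardEqFinrank hli (by simp)
  refine (Ψ.map_basis_ne_zero_iff B).2 hΨ ?_
  rwa [coe_basisOfLinearIndependentOfCardEqFinrank]

end Frames

/-! ### Induced structures and the equiaffine normal. -/

section Induced

/-- Project the constant field `v` to the tangent spaces along a fixed transverse direction. Such
extensions are needed to apply the Gauss formula to a given tangent vector. -/
lemma exists_tangent_field (hF : ContDiffAt ℝ ∞ F x) (hx : fderiv ℝ F x ≠ 0)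
    (v : tangent F x) : ∃ Y : Space n → Space n, ContDiffAt ℝ ∞ Y x ∧
      (∀ᶠ y in 𝓝 x, Y y ∈ tangent F y) ∧ Y x = v := by
  obtain ⟨w, hw⟩ : ∃ w, fderiv ℝ F x w ≠ 0 := by
    by_contra! h
    exact hx (ContinuousLinearMap.ext h)
  have hd := contDiffAt_fderiv hF
  have hw' : ContDiffAt ℝ ∞ (fun y => fderiv ℝ F y w) x := hd.clm_apply contDiffAt_const
  refine ⟨fun y => (v : Space n) - (fderiv ℝ F y v * (fderiv ℝ F y w)⁻¹) • w, ?_, ?_, ?_⟩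
  · exact contDiffAt_const.sub
      (((hd.clm_apply contDiffAt_const).mul (hw'.inv hw)).smul contDiffAt_const)
  · filter_upwards [hw'.continuousAt.eventually_ne hw] with y hy
    simp [hy]
  · have h : fderiv ℝ F x (v : Space n) = 0 := v.2
    simp [h]

lemma fderiv_fderiv_apply (hF : ContDiffAt ℝ ∞ F x) {Y : Space n → Space n}
    (hY : DifferentiableAt ℝ Y x) (v : Space n) :
    fderiv ℝ (fun y => fderiv ℝ F y (Y y)) x v =
      hessForm F x v (Y x) + fderiv ℝ F x (fderiv ℝ Y x v) := by
  have h := ((contDiffAt_fderiv hF).differentiableAt (by simp)).hasFDerivAt.clm_apply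
    hY.hasFDerivAt
  refine (congrArg (fun m : Space n →L[ℝ] ℝ => m v) h.fderiv).trans ?_
  simp [add_comm]

lemma fderiv_fderiv_of_tangent (hF : ContDiffAt ℝ ∞ F x) {Y : Space n → Space n}
    (hY : DifferentiableAt ℝ Y x) (hYt : ∀ᶠ y in 𝓝 x, Y y ∈ tangent F y) (v : Space n) :
    fderiv ℝ F x (fderiv ℝ Y x v) = -hessForm F x v (Y x) := by
  have h1 : (fun y => fderiv ℝ F y (Y y)) =ᶠ[𝓝 x] fun _ => (0 : ℝ) := by
    filter_upwards [hYt] with y hy using hy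
  have h2 := fderiv_fderiv_apply hF hY v
  rw [h1.fderiv_eq, fderiv_fun_const] at h2
  simp only [Pi.zero_apply, zero_apply] at h2
  linarith

/-- The second fundamental form induced by a transverse field is a multiple of the Hessian. -/
lemma IsInduced.apply_mul (hF : ContDiffAt ℝ ∞ F x) (hx : fderiv ℝ F x ≠ 0)
    {N : Space n → Space n} {h : LinearMap.BilinForm ℝ (tangent F x)}
    {S : tangent F x →ₗ[ℝ] tangent F x} {τ : tangent F x →ₗ[ℝ] ℝ}
    (hI : IsInduced F N x h S τ) (X Y : tangent F x) :
    h X Y * fderiv ℝ F x (N x) = -hessForm F x X Y := by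
  obtain ⟨Y', hY', hYt, hYx⟩ := exists_tangent_field hF hx Y
  have h1 : fderiv ℝ F x (fderiv ℝ Y' x X - h X Y • N x) = 0 :=
    hI.gauss Y' hY' hYt X Y hYx.symm
  rw [map_sub, map_smul, fderiv_fderiv_of_tangent hF (hY'.differentiableAt (by simp)) hYt, hYx,
    smul_eq_mul] at h1
  linarith

lemma IsInduced.abs_det (hF : ContDiffAt ℝ ∞ F x) (hx : fderiv ℝ F x ≠ 0)
    {N : Space n → Space n} {h : LinearMap.BilinForm ℝ (tangent F x)}
    {S : tangent F x →ₗ[ℝ] tangent F x} {τ : tangent F x →ₗ[ℝ] ℝ}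
    (hI : IsInduced F N x h S τ) (X : Fin n → tangent F x) :
    |(Matrix.of fun i j => h (X i) (X j)).det| =
      (|fderiv ℝ F x (N x)| ^ n)⁻¹ * |(gram F x X).det| := by
  have hN : fderiv ℝ F x (N x) ≠ 0 := hI.transverse
  have h1 : (Matrix.of fun i j => h (X i) (X j)) =
      (-(fderiv ℝ F x (N x))⁻¹) • gram F x X := by
    ext i j
    have := hI.apply_mul hF hx (X i) (X j)
    simp only [Matrix.of_apply, Matrix.smul_apply, gram, smul_eq_mul]
    field_simp
    linarith
  rw [h1, Matrix.det_smul, abs_mul, abs_pow, abs_neg, abs_inv, Fintype.card_fin, inv_pow]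

/-- `dF(F^♯) = U/H` has the sign of `U H`, so the co-orientation always points towards decreasing
`F`. -/
lemma sign_mul_pos (hH : hessDet Ψ F x ≠ 0) (hU : uFun Ψ F x ≠ 0) :
    fderiv ℝ F x (-(Real.sign (uFun Ψ F x * hessDet Ψ F x)) • hessGrad F x) < 0 := by
  rw [map_smul, fderiv_hessGrad hH, smul_eq_mul, neg_mul, neg_lt_zero]
  have h1 : uFun Ψ F x * (hessDet Ψ F x)⁻¹ =
      (uFun Ψ F x * hessDet Ψ F x) * ((hessDet Ψ F x)⁻¹) ^ 2 := by field_simp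
  rw [h1, ← mul_assoc]
  have h2 : 0 < Real.sign (uFun Ψ F x * hessDet Ψ F x) * (uFun Ψ F x * hessDet Ψ F x) :=
    Real.sign_mul_pos_of_ne_zero _ (mul_ne_zero hU hH)
  positivity

/-- The normalization of the equiaffine normal amounts to `dF(N) = -|U(F)|^{1/(n+2)}`. -/
lemma IsEquiaffineNormal.fderiv_apply (hF : ∀ x ∈ W, ContDiffAt ℝ ∞ F x)
    (hH : ∀ x ∈ W, hessDet Ψ F x ≠ 0) (hU : ∀ x ∈ W, uFun Ψ F x ≠ 0)
    {N : Space n → Space n} (hN : IsEquiaffineNormal Ψ F W N) (hx : x ∈ W) :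
    fderiv ℝ F x (N x) = -uPow Ψ F x := by
  obtain ⟨h, S, τ, hI, -, hdet⟩ := hN.normalized x hx
  obtain ⟨X, hX⟩ := exists_gram_det_ne_zero (hF x hx) (hH x hx) (hU x hx)
  have h0 : fderiv ℝ F x (N x) ≠ 0 := hI.transverse
  have h1 := hdet X
  rw [hI.abs_det (hF x hx) (fderiv_ne_zero (hH x hx) (hU x hx)),
    volForm_cons_sq (hF x hx) (hH x hx) (hU x hx), ← sq_abs (fderiv ℝ F x (N x))] at h1
  -- One side of the normalization carries `|dF(N)|^{-n}`, the other `dF(N)² |U|⁻¹`. Cancelling the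
  -- Gram determinant leaves `|dF(N)|^{n+2} = |U|`, the source of the exponent `1/(n+2)`.
  have h2 : |fderiv ℝ F x (N x)| ^ (n + 2) = uPow Ψ F x ^ (n + 2) := by
    rw [uPow_pow]
    have ha : |fderiv ℝ F x (N x)| ≠ 0 := abs_ne_zero.2 h0
    have hb : |uFun Ψ F x| ≠ 0 := abs_ne_zero.2 (hU x hx)
    have hc : |(gram F x X).det| ≠ 0 := abs_ne_zero.2 hX
    field_simp at h1
    rw [h1]
    ring
  have h3 : |fderiv ℝ F x (N x)| = uPow Ψ F x :=
    (pow_left_inj₀ (abs_nonneg _) (uPow_pos (hU x hx)).le (by omega)).1 h2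
  have h4 : fderiv ℝ F x (N x) < 0 := by
    by_contra! h5
    exact absurd (hN.cooriented x hx)
      (not_lt.2 (mul_nonpos_of_nonneg_of_nonpos h5 (sign_mul_pos (hH x hx) (hU x hx)).le))
  rw [abs_of_neg h4] at h3
  linarith

/-- The derivative of `dF(N) = -|U(F)|^{1/(n+2)}`. -/
lemma hessForm_add_fderiv (hF : ContDiffAt ℝ ∞ F x) (hU : uFun Ψ F x ≠ 0)
    {N : Space n → Space n} (hNd : DifferentiableAt ℝ N x)
    (hN : ∀ᶠ y in 𝓝 x, fderiv ℝ F y (N y) = -uPow Ψ F y) (v : Space n) :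
    hessForm F x v (N x) + fderiv ℝ F x (fderiv ℝ N x v) = -(uPow Ψ F x * muForm Ψ F x v) := by
  have h1 : (fun y => fderiv ℝ F y (N y)) =ᶠ[𝓝 x] fun y => -uPow Ψ F y := hN
  rw [← fderiv_fderiv_apply hF hNd, h1.fderiv_eq, fderiv_fun_neg, fderiv_uPow hF hU]
  simp

/-- A sufficient condition for `N` to be the equiaffine normal. -/
lemma isEquiaffineNormal_of_fderiv (hF : ∀ x ∈ W, ContDiffAt ℝ ∞ F x)
    (hH : ∀ x ∈ W, hessDet Ψ F x ≠ 0) (hU : ∀ x ∈ W, uFun Ψ F x ≠ 0)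
    {N : Space n → Space n} (hN : ContDiffOn ℝ ∞ N W)
    (h1 : ∀ x ∈ W, fderiv ℝ F x (N x) = -uPow Ψ F x)
    (h2 : ∀ x ∈ W, ∀ X ∈ tangent F x, fderiv ℝ N x X ∈ tangent F x) :
    IsEquiaffineNormal Ψ F W N := by
  refine ⟨hN, fun x hx => ?_, fun x hx => ?_⟩
  · have hNx : fderiv ℝ F x (N x) ≠ 0 := by
      rw [h1 x hx]
      exact neg_ne_zero.2 (uPow_pos (hU x hx)).ne'
    let h : LinearMap.BilinForm ℝ (tangent F x) :=
      LinearMap.mk₂ ℝ (fun X Y => -(fderiv ℝ F x (N x))⁻¹ * hessForm F x X Y)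
        (fun a b c => by simp; ring) (fun a b c => by simp; ring) (fun a b c => by simp; ring)
        (fun a b c => by simp; ring)
    let S : tangent F x →ₗ[ℝ] tangent F x :=
      -((fderiv ℝ N x).toLinearMap.restrict (fun X hX => h2 x hx X hX))
    have hI : IsInduced F N x h S 0 := by
      refine ⟨hNx, fun Y hY hYt X Yx hYx => ?_, fun X => ?_⟩
      · change fderiv ℝ F x (_ - (-(fderiv ℝ F x (N x))⁻¹ * hessForm F x X Yx) • N x) = 0
        rw [map_sub, map_smul,
          fderiv_fderiv_of_tangent (hF x hx) (hY.differentiableAt (by simp)) hYt, hYx, smul_eq_mul]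
        field_simp
        ring
      · simp [S]
    refine ⟨h, S, 0, hI, rfl, fun X => ?_⟩
    rw [hI.abs_det (hF x hx) (fderiv_ne_zero (hH x hx) (hU x hx)),
      volForm_cons_sq (hF x hx) (hH x hx) (hU x hx), h1 x hx, abs_neg, neg_sq, ← uPow_pow,
      abs_of_pos (uPow_pos (hU x hx))]
    have := (uPow_pos (hU x hx)).ne'
    field_simp
    ring
  · rw [h1 x hx]
    exact mul_pos_of_neg_of_neg (neg_neg_of_pos (uPow_pos (hU x hx)))
      (sign_mul_pos (hH x hx) (hU x hx))

lemma IsEquiaffineNormal.fderiv_mem_tangent {N : Space n → Space n}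
    (hN : IsEquiaffineNormal Ψ F W N) (hx : x ∈ W) (X : tangent F x) :
    fderiv ℝ N x X ∈ tangent F x := by
  obtain ⟨h, S, τ, hI, rfl, -⟩ := hN.normalized x hx
  rw [hI.weingarten X]
  simp

/-- `g(N, ·) = -|U|^{1/(n+2)} (μ + A H U⁻¹ dF)` for the equiaffine normal `N`. -/
lemma IsEquiaffineNormal.hessForm_apply (hW : IsOpen W) (hF : ∀ x ∈ W, ContDiffAt ℝ ∞ F x)
    (hH : ∀ x ∈ W, hessDet Ψ F x ≠ 0) (hU : ∀ x ∈ W, uFun Ψ F x ≠ 0)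
    {N : Space n → Space n} (hN : IsEquiaffineNormal Ψ F W N) (hx : x ∈ W) (v : Space n) :
    hessForm F x (N x) v = -(uPow Ψ F x * (muForm Ψ F x v +
      aFun Ψ F x * hessDet Ψ F x * (uFun Ψ F x)⁻¹ * fderiv ℝ F x v)) := by
  have hd : DifferentiableAt ℝ N x :=
    (hN.smooth.contDiffAt (hW.mem_nhds hx)).differentiableAt (by simp)
  have hT : ∀ X ∈ tangent F x, hessForm F x (N x) X = -(uPow Ψ F x * muForm Ψ F x X) := by
    intro X hX
    have h1 := hessForm_add_fderiv (hF x hx) (hU x hx) hd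
      (eventually_of_mem (hW.mem_nhds hx) fun y hy => hN.fderiv_apply hF hH hU hy) X
    have h2 : fderiv ℝ F x (fderiv ℝ N x X) = 0 := hN.fderiv_mem_tangent hx ⟨X, hX⟩
    rw [hessForm_comm (hF x hx)]
    linarith
  have hdet := det_hess_ne_zero (hH x hx)
  have hG := fderiv_hessGrad (hH x hx)
  have hU0 := hU x hx
  have hH0 := hH x hx
  -- With this `c` the vector `v - c F^♯` is tangent, because `dF(F^♯) = U/H`.
  set c := fderiv ℝ F x v * hessDet Ψ F x * (uFun Ψ F x)⁻¹ with hc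
  have hX := hT (v - c • hessGrad F x) (by
    change fderiv ℝ F x _ = 0
    rw [map_sub, map_smul, hG, smul_eq_mul, hc]
    field_simp
    ring)
  rw [map_sub, map_sub, map_smul, map_smul, hessForm_comm (hF x hx) (N x) (hessGrad F x),
    hessForm_hessGrad (hF x hx) hdet, hN.fderiv_apply hF hH hU hx, smul_eq_mul, smul_eq_mul] at hX
  have hA : muForm Ψ F x (hessGrad F x) = 1 - aFun Ψ F x := by
    rw [aFun]
    ring
  rw [hA] at hX
  rw [hc] at hX
  linear_combination hX

/-- `dF(D_v N)` for the equiaffine normal `N`. -/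
lemma IsEquiaffineNormal.fderiv_fderiv_apply (hW : IsOpen W) (hF : ∀ x ∈ W, ContDiffAt ℝ ∞ F x)
    (hH : ∀ x ∈ W, hessDet Ψ F x ≠ 0) (hU : ∀ x ∈ W, uFun Ψ F x ≠ 0)
    {N : Space n → Space n} (hN : IsEquiaffineNormal Ψ F W N) (hx : x ∈ W) (v : Space n) :
    fderiv ℝ F x (fderiv ℝ N x v) =
      uPow Ψ F x * aFun Ψ F x * hessDet Ψ F x * (uFun Ψ F x)⁻¹ * fderiv ℝ F x v := by
  have hd : DifferentiableAt ℝ N x :=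
    (hN.smooth.contDiffAt (hW.mem_nhds hx)).differentiableAt (by simp)
  have h1 := hessForm_add_fderiv (hF x hx) (hU x hx) hd
    (eventually_of_mem (hW.mem_nhds hx) fun y hy => hN.fderiv_apply hF hH hU hy) v
  rw [hessForm_comm (hF x hx), hN.hessForm_apply hW hF hH hU hx] at h1
  linear_combination h1

/-- The equiaffine normals of the level sets form a smooth vector field. -/
lemma exists_isEquiaffineNormal (hW : IsOpen W) (hF : ∀ x ∈ W, ContDiffAt ℝ ∞ F x)
    (hH : ∀ x ∈ W, hessDet Ψ F x ≠ 0) (hU : ∀ x ∈ W, uFun Ψ F x ≠ 0) :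
    ∃ N : Space n → Space n, IsEquiaffineNormal Ψ F W N := by
  -- The only possible candidate: the formula of `IsEquiaffineNormal.hessForm_apply` with its index
  -- raised.
  let N : Space n → Space n := fun y => -uPow Ψ F y • (sharp F y (muForm Ψ F y) +
    (aFun Ψ F y * hessDet Ψ F y * (uFun Ψ F y)⁻¹) • hessGrad F y)
  have hNc : ∀ x ∈ W, ContDiffAt ℝ ∞ N x := by
    intro x hx
    have hdet := det_hess_ne_zero (hH x hx)
    have hFx := hF x hx
    exact (contDiffAt_uPow hFx (hU x hx)).neg.smul
      ((contDiffAt_sharp hFx hdet (contDiffAt_muForm hFx (hU x hx))).add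
        ((((contDiffAt_aFun hFx (hH x hx) (hU x hx)).mul (contDiffAt_hessDet hFx)).mul
          ((contDiffAt_uFun hFx).inv (hU x hx))).smul (contDiffAt_hessGrad hFx hdet)))
  have h1 : ∀ x ∈ W, fderiv ℝ F x (N x) = -uPow Ψ F x := by
    intro x hx
    have hU0 := hU x hx
    have hH0 := hH x hx
    have hA : muForm Ψ F x (hessGrad F x) = 1 - aFun Ψ F x := by
      rw [aFun]
      ring
    simp only [N]
    rw [map_smul, map_add, map_smul, fderiv_sharp (hF x hx) (det_hess_ne_zero (hH x hx)),
      fderiv_hessGrad (hH x hx), hA, smul_eq_mul, smul_eq_mul]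
    field_simp
    ring
  refine ⟨N, isEquiaffineNormal_of_fderiv hF hH hU
    (fun x hx => (hNc x hx).contDiffWithinAt) h1 fun x hx X hX => ?_⟩
  have hdet := det_hess_ne_zero (hH x hx)
  have h2 := hessForm_add_fderiv (hF x hx) (hU x hx) ((hNc x hx).differentiableAt (by simp))
    (eventually_of_mem (hW.mem_nhds hx) h1) X
  have h3 : hessForm F x X (N x) = -(uPow Ψ F x * muForm Ψ F x X) := by
    have hX' : fderiv ℝ F x X = 0 := hX
    rw [hessForm_comm (hF x hx)]
    simp only [N]
    rw [map_smul, map_add, map_smul, smul_apply, add_apply, smul_apply,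
      hessForm_sharp (hF x hx) hdet, hessForm_hessGrad (hF x hx) hdet, hX']
    simp
  change fderiv ℝ F x _ = 0
  linarith

end Induced

end LevelSetAffine

namespace LevelSetAffine

variable {n : ℕ} {Ψ : VolForm n} {F : Space n → ℝ} {W : Set (Space n)} {x : Space n}
  {N : Space n → Space n}

/-! ### Each condition is equivalent to `μ` being a multiple of `dF`. -/

section Equivalences

lemma muForm_eq_of_eq_smul (hH : hessDet Ψ F x ≠ 0) (hU : uFun Ψ F x ≠ 0) {c : ℝ}
    (h : muForm Ψ F x = c • fderiv ℝ F x) :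
    c = (uFun Ψ F x)⁻¹ * hessDet Ψ F x * (1 - aFun Ψ F x) := by
  have h1 : muForm Ψ F x (hessGrad F x) = 1 - aFun Ψ F x := by
    rw [aFun]
    ring
  rw [← h1, h, smul_apply, fderiv_hessGrad hH, smul_eq_mul]
  field_simp

lemma fderiv_uFun (hU : uFun Ψ F x ≠ 0) :
    fderiv ℝ (uFun Ψ F) x = (((n : ℝ) + 2) * uFun Ψ F x) • muForm Ψ F x := by
  have h : (n : ℝ) + 2 ≠ 0 := by positivity
  rw [muForm, smul_smul]
  field_simp
  rw [one_smul]

lemma fderiv_conormal_apply (hF : ContDiffAt ℝ ∞ F x) (hU : uFun Ψ F x ≠ 0) (u v : Space n) :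
    fderiv ℝ (conormal Ψ F) x u v =
      (uPow Ψ F x)⁻¹ * (muForm Ψ F x u * fderiv ℝ F x v - hessForm F x u v) := by
  have h1 := ((contDiffAt_uPow (Ψ := Ψ) hF hU).differentiableAt (by simp)).hasFDerivAt
  rw [fderiv_uPow hF hU] at h1
  have h2 := ((contDiffAt_fderiv hF).differentiableAt (by simp)).hasFDerivAt
  have hf := (uPow_pos hU).ne'
  have h3 := ((hasDerivAt_inv hf).comp_hasFDerivAt x h1).neg.smul h2
  have h4 : conormal Ψ F = fun y => (-(uPow Ψ F y)⁻¹) • fderiv ℝ F y := funext fun y => conormal_eq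
  rw [h4]
  refine (congrArg (fun m : Space n →L[ℝ] Space n →L[ℝ] ℝ => m u v) h3.fderiv).trans ?_
  simp
  field_simp
  ring

lemma contDiffAt_conormal (hF : ContDiffAt ℝ ∞ F x) (hU : uFun Ψ F x ≠ 0) :
    ContDiffAt ℝ ∞ (conormal Ψ F) x := by
  have h : conormal Ψ F = fun y => (-(uPow Ψ F y)⁻¹) • fderiv ℝ F y := funext fun y => conormal_eq
  rw [h]
  exact (((contDiffAt_uPow hF hU).inv (uPow_pos hU).ne').neg).smul (contDiffAt_fderiv hF)

lemma extD_apply {α : Space n → Space n →L[ℝ] ℝ} (hα : DifferentiableAt ℝ α x)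
    (v : Fin 2 → Space n) :
    extD α x v = fderiv ℝ α x (v 0) (v 1) - fderiv ℝ α x (v 1) (v 0) := by
  have h : HasFDerivAt (fun y => ContinuousAlternatingMap.ofSubsingleton ℝ (Space n) ℝ
      (0 : Fin 1) (α y)) _ x :=
    ((ContinuousAlternatingMap.ofSubsingletonLIE (𝕜 := ℝ) (E := Space n) (F := ℝ)
      (0 : Fin 1)).toContinuousLinearEquiv.toContinuousLinearMap.hasFDerivAt).comp x
      hα.hasFDerivAt
  rw [extD, extDeriv, h.fderiv, ContinuousAlternatingMap.alternatizeUncurryFin_apply,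
    Fin.sum_univ_two]
  have e1 : ∀ u w : Space n, ((ContinuousAlternatingMap.ofSubsingletonLIE (𝕜 := ℝ)
      (E := Space n) (F := ℝ) (0 : Fin 1)).toContinuousLinearEquiv.toContinuousLinearMap.comp
      (fderiv ℝ α x)) u ![w] = fderiv ℝ α x u w := fun u w => rfl
  have e2 : (0 : Fin 2).removeNth v = ![v 1] := by
    funext i
    fin_cases i
    rfl
  have e3 : (1 : Fin 2).removeNth v = ![v 0] := by
    funext i
    fin_cases i
    rfl
  rw [e2, e3, e1, e1]
  simp
  ring

/-- As `ν = -f⁻¹ dF` and `d log f = μ`, only `-μ ∧ ν` remains: the Hessian term is symmetric and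
drops out. -/
lemma extD_conormal_apply (hF : ContDiffAt ℝ ∞ F x) (hU : uFun Ψ F x ≠ 0)
    (v : Fin 2 → Space n) :
    extD (conormal Ψ F) x v = -wedge (muForm Ψ F) (conormal Ψ F) x (v 0) (v 1) := by
  rw [extD_apply ((contDiffAt_conormal hF hU).differentiableAt (by simp)),
    fderiv_conormal_apply hF hU, fderiv_conormal_apply hF hU, hessForm_comm hF (v 1), wedge,
    conormal_eq]
  simp only [smul_apply, smul_eq_mul]
  ring

lemma extD_conormal_eq_zero_iff (hF : ContDiffAt ℝ ∞ F x) (hU : uFun Ψ F x ≠ 0) :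
    extD (conormal Ψ F) x = 0 ↔ ∀ u v, wedge (muForm Ψ F) (conormal Ψ F) x u v = 0 := by
  constructor
  · intro h u v
    have h1 := extD_conormal_apply hF hU ![u, v]
    rw [h] at h1
    simpa using h1.symm
  · intro h
    ext v
    rw [extD_conormal_apply hF hU, h]
    simp

lemma wedge_eq_zero_iff (hH : hessDet Ψ F x ≠ 0) (hU : uFun Ψ F x ≠ 0) :
    (∀ u v, wedge (muForm Ψ F) (conormal Ψ F) x u v = 0) ↔
      ∃ c : ℝ, muForm Ψ F x = c • fderiv ℝ F x := by
  have hf := (uPow_pos hU).ne'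
  have hG : fderiv ℝ F x (hessGrad F x) ≠ 0 := by
    rw [fderiv_hessGrad hH]
    exact mul_ne_zero hU (inv_ne_zero hH)
  simp only [wedge, conormal_eq, smul_apply, smul_eq_mul]
  constructor
  · intro h
    refine ⟨muForm Ψ F x (hessGrad F x) * (fderiv ℝ F x (hessGrad F x))⁻¹, ?_⟩
    ext u
    have h1 := h u (hessGrad F x)
    simp only [smul_apply, smul_eq_mul]
    field_simp at h1 ⊢
    linarith
  · rintro ⟨c, hc⟩ u v
    rw [hc]
    simp only [smul_apply, smul_eq_mul]
    ring

lemma muForm_eq_iff (hH : hessDet Ψ F x ≠ 0) (hU : uFun Ψ F x ≠ 0) :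
    muForm Ψ F x = ((uFun Ψ F x)⁻¹ * hessDet Ψ F x * (1 - aFun Ψ F x)) • fderiv ℝ F x ↔
      ∃ c : ℝ, muForm Ψ F x = c • fderiv ℝ F x :=
  ⟨fun h => ⟨_, h⟩, fun ⟨c, hc⟩ => by rwa [← muForm_eq_of_eq_smul hH hU hc]⟩

/-- The `A H U⁻¹ dF` term of `g(N, ·)` cancels against the one from `dF(D_v N)`. -/
lemma lieD_conormal_apply (hW : IsOpen W) (hF : ∀ x ∈ W, ContDiffAt ℝ ∞ F x)
    (hH : ∀ x ∈ W, hessDet Ψ F x ≠ 0) (hU : ∀ x ∈ W, uFun Ψ F x ≠ 0)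
    (hN : IsEquiaffineNormal Ψ F W N) (hx : x ∈ W) (v : Space n) :
    lieD N (conormal Ψ F) x v = muForm Ψ F x v +
      (uPow Ψ F x)⁻¹ * muForm Ψ F x (N x) * fderiv ℝ F x v := by
  have hf := (uPow_pos (hU x hx)).ne'
  rw [lieD, add_apply, fderiv_conormal_apply (hF x hx) (hU x hx),
    ContinuousLinearMap.comp_apply, conormal_eq, smul_apply, smul_eq_mul,
    hN.fderiv_fderiv_apply hW hF hH hU hx, hN.hessForm_apply hW hF hH hU hx]
  field_simp
  ring

lemma lieD_conormal_eq_zero_iff (hW : IsOpen W) (hF : ∀ x ∈ W, ContDiffAt ℝ ∞ F x)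
    (hH : ∀ x ∈ W, hessDet Ψ F x ≠ 0) (hU : ∀ x ∈ W, uFun Ψ F x ≠ 0)
    (hN : IsEquiaffineNormal Ψ F W N) (hx : x ∈ W) :
    lieD N (conormal Ψ F) x = 0 ↔ ∃ c : ℝ, muForm Ψ F x = c • fderiv ℝ F x := by
  have hf := (uPow_pos (hU x hx)).ne'
  constructor
  · intro h
    refine ⟨-((uPow Ψ F x)⁻¹ * muForm Ψ F x (N x)), ?_⟩
    ext v
    have h1 := lieD_conormal_apply hW hF hH hU hN hx v
    rw [h, zero_apply] at h1
    simp only [smul_apply, smul_eq_mul]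
    linarith
  · rintro ⟨c, hc⟩
    ext v
    rw [lieD_conormal_apply hW hF hH hU hN hx, hc]
    simp only [smul_apply, smul_eq_mul, hN.fderiv_apply hF hH hU hx, zero_apply]
    field_simp
    ring

lemma eq_smul_hessGrad_iff (hW : IsOpen W) (hF : ∀ x ∈ W, ContDiffAt ℝ ∞ F x)
    (hH : ∀ x ∈ W, hessDet Ψ F x ≠ 0) (hU : ∀ x ∈ W, uFun Ψ F x ≠ 0)
    (hN : IsEquiaffineNormal Ψ F W N) (hx : x ∈ W) :
    (∃ c : ℝ, N x = c • hessGrad F x) ↔ ∃ c : ℝ, muForm Ψ F x = c • fderiv ℝ F x := by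
  have hdet := det_hess_ne_zero (hH x hx)
  have hf := (uPow_pos (hU x hx)).ne'
  constructor
  · rintro ⟨c, hc⟩
    refine ⟨-((uPow Ψ F x)⁻¹ * c + aFun Ψ F x * hessDet Ψ F x * (uFun Ψ F x)⁻¹), ?_⟩
    ext v
    have h1 := hN.hessForm_apply hW hF hH hU hx v
    rw [hc, map_smul, smul_apply, hessForm_hessGrad (hF x hx) hdet, smul_eq_mul] at h1
    simp only [smul_apply, smul_eq_mul]
    have h2 : c = (uPow Ψ F x)⁻¹ * c * uPow Ψ F x := by field_simp
    rw [h2] at h1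
    refine mul_left_cancel₀ hf ?_
    linear_combination h1
  · rintro ⟨c, hc⟩
    refine ⟨-(uPow Ψ F x * (c + aFun Ψ F x * hessDet Ψ F x * (uFun Ψ F x)⁻¹)),
      eq_of_hessForm_eq (hF x hx) hdet fun w => ?_⟩
    rw [hN.hessForm_apply hW hF hH hU hx, map_smul, smul_apply,
      hessForm_hessGrad (hF x hx) hdet, hc, smul_apply, smul_eq_mul, smul_eq_mul]
    ring

lemma eq_neg_normalFactor_smul_iff (hF : ∀ x ∈ W, ContDiffAt ℝ ∞ F x)
    (hH : ∀ x ∈ W, hessDet Ψ F x ≠ 0) (hU : ∀ x ∈ W, uFun Ψ F x ≠ 0)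
    (hN : IsEquiaffineNormal Ψ F W N) (hx : x ∈ W) :
    N x = (-normalFactor Ψ F x) • hessGrad F x ↔ ∃ c : ℝ, N x = c • hessGrad F x := by
  refine ⟨fun h => ⟨_, h⟩, ?_⟩
  rintro ⟨c, hc⟩
  have h1 := hN.fderiv_apply hF hH hU hx
  have hU0 := hU x hx
  have hH0 := hH x hx
  rw [hc, map_smul, fderiv_hessGrad hH0, smul_eq_mul] at h1
  have h2 : c = -normalFactor Ψ F x := by
    rw [normalFactor_eq hU0]
    field_simp at h1 ⊢
    linarith
  rw [hc, h2]

lemma eventually_eq_of_isLocallyConstant {U : Space n → ℝ} (hW : IsOpen W) (hx : x ∈ W)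
    (h : IsLocallyConstant (fun y : levelSet F W (F x) => U y)) :
    ∀ᶠ y in 𝓝 x, F y = F x → U y = U x := by
  have h1 := h.eventually_eq ⟨x, hx, rfl⟩
  rw [nhds_subtype, eventually_comap] at h1
  filter_upwards [h1, hW.mem_nhds hx] with y hy hyW hFy
  exact hy ⟨y, hyW, hFy⟩ rfl

lemma isLocallyConstant_of_eventually_eq {U : Space n → ℝ} {r : ℝ}
    (h : ∀ x ∈ W, ∀ᶠ y in 𝓝 x, F y = F x → U y = U x) :
    IsLocallyConstant (fun y : levelSet F W r => U y) := by
  rw [IsLocallyConstant.iff_eventually_eq]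
  rintro ⟨x, hx, hFx⟩
  filter_upwards [continuous_subtype_val.continuousAt.eventually (h x hx)] with y hy
  exact hy (y.2.2.trans hFx.symm)

lemma exists_muForm_eq_of_fderiv_eq {c : ℝ}
    (h : fderiv ℝ (uFun Ψ F) x = c • fderiv ℝ F x) :
    ∃ c : ℝ, muForm Ψ F x = c • fderiv ℝ F x :=
  ⟨_, by rw [muForm, h, smul_smul]⟩

lemma forall_isLocallyConstant_iff {I : Set ℝ} (hW : IsOpen W) (hWI : ∀ x ∈ W, F x ∈ I)
    (hF : ∀ x ∈ W, ContDiffAt ℝ ∞ F x)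
    (hH : ∀ x ∈ W, hessDet Ψ F x ≠ 0) (hU : ∀ x ∈ W, uFun Ψ F x ≠ 0) :
    (∀ r ∈ I, IsLocallyConstant (fun x : levelSet F W r => uFun Ψ F x)) ↔
      ∀ x ∈ W, ∃ c : ℝ, muForm Ψ F x = c • fderiv ℝ F x := by
  have h1 : (1 : ℕ∞ω) ≤ ∞ := one_le_two.trans two_le_infty
  constructor
  · intro h x hx
    obtain ⟨c, hc⟩ := exists_fderiv_eq_smul_of_locallyConstant ((hF x hx).of_le h1)
      ((contDiffAt_uFun (hF x hx)).of_le h1) (fderiv_ne_zero (hH x hx) (hU x hx))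
      (eventually_eq_of_isLocallyConstant hW hx (h _ (hWI x hx)))
    exact exists_muForm_eq_of_fderiv_eq hc
  · intro h r _
    refine isLocallyConstant_of_eventually_eq fun x hx => ?_
    obtain ⟨L, -, hL⟩ := exists_abs_sub_le_of_fderiv_ker ((hF x hx).of_le h1)
      ((contDiffAt_uFun (Ψ := Ψ) (hF x hx)).of_le h1) (fderiv_ne_zero (hH x hx) (hU x hx))
      (by
        filter_upwards [hW.mem_nhds hx] with y hy v hv
        obtain ⟨c, hc⟩ := h y hy
        rw [fderiv_uFun (hU y hy), hc, smul_apply, smul_apply, hv]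
        simp)
    rw [← nhds_prod_eq] at hL
    have hp : Tendsto (fun y : Space n => (y, x)) (𝓝 x) (𝓝 (x, x)) :=
      (Continuous.prodMk_left x).tendsto x
    filter_upwards [hp.eventually hL] with y hy hFy
    simp only [hFy, sub_self, abs_zero, mul_zero] at hy
    exact sub_eq_zero.1 (abs_nonpos_iff.1 hy)

lemma flowPreservesLevelSets_iff (hW : IsOpen W) (hF : ∀ x ∈ W, ContDiffAt ℝ ∞ F x)
    (hH : ∀ x ∈ W, hessDet Ψ F x ≠ 0) (hU : ∀ x ∈ W, uFun Ψ F x ≠ 0)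
    (hN : IsEquiaffineNormal Ψ F W N) :
    FlowPreservesLevelSets F W N ↔ ∀ x ∈ W, ∃ c : ℝ, muForm Ψ F x = c • fderiv ℝ F x := by
  have h1 : (1 : ℕ∞ω) ≤ ∞ := one_le_two.trans two_le_infty
  constructor
  · intro h x hx
    have hx0 := fderiv_ne_zero (hH x hx) (hU x hx)
    have h2 := h.fderiv_apply_eq hW (hN.smooth.of_le h1)
      (fun y hy => ((hF y hy).of_le h1).contDiffWithinAt) hx hx0
    obtain ⟨c, hc⟩ := exists_fderiv_eq_smul_of_locallyConstant ((hF x hx).of_le h1)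
      ((contDiffAt_uPow (Ψ := Ψ) (hF x hx) (hU x hx)).of_le h1) hx0 (by
        filter_upwards [h2, hW.mem_nhds hx] with y hy hyW hFy
        have h3 := hy hFy
        rw [hN.fderiv_apply hF hH hU hx, hN.fderiv_apply hF hH hU hyW] at h3
        exact neg_injective h3)
    rw [fderiv_uPow (hF x hx) (hU x hx)] at hc
    refine ⟨(uPow Ψ F x)⁻¹ * c, ?_⟩
    rw [mul_smul, ← hc, smul_smul, inv_mul_cancel₀ (uPow_pos (hU x hx)).ne', one_smul]
  · intro h
    refine flowPreservesLevelSets_of_fderiv_apply (φ := fun y => -uPow Ψ F y) hW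
      (hN.smooth.of_le h1)
      (fun y hy => ((hF y hy).differentiableAt (by simp)).differentiableWithinAt)
      (fun y hy => hN.fderiv_apply hF hH hU hy) fun p hp => ?_
    refine exists_abs_sub_le_of_fderiv_ker ((hF p hp).of_le h1)
      ((contDiffAt_uPow (hF p hp) (hU p hp)).neg.of_le h1) (fderiv_ne_zero (hH p hp) (hU p hp)) ?_
    filter_upwards [hW.mem_nhds hp] with y hy v hv
    obtain ⟨c, hc⟩ := h y hy
    rw [fderiv_fun_neg, fderiv_uPow (hF y hy) (hU y hy), hc, neg_apply, smul_apply, smul_apply, hv]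
    simp

end Equivalences

/-! ### The shape tensor and the affine mean curvature. -/

section Shape

/-- The `ν ⊗ N` term cancels the transverse part of `-D_v N` for every `v`, tangent or not. None of
the equivalent conditions is needed. -/
lemma fderiv_shapeTensor (hW : IsOpen W) (hF : ∀ x ∈ W, ContDiffAt ℝ ∞ F x)
    (hH : ∀ x ∈ W, hessDet Ψ F x ≠ 0) (hU : ∀ x ∈ W, uFun Ψ F x ≠ 0)
    (hN : IsEquiaffineNormal Ψ F W N) (hx : x ∈ W) (v : Space n) :
    fderiv ℝ F x (shapeTensor Ψ F N x v) = 0 := by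
  have hf := (uPow_pos (hU x hx)).ne'
  rw [shapeTensor, add_apply, neg_apply, smul_apply, ContinuousLinearMap.smulRight_apply, map_add,
    map_neg, map_smul, map_smul, hN.fderiv_fderiv_apply hW hF hH hU hx,
    hN.fderiv_apply hF hH hU hx, conormal_eq, normalFactor_eq (hU x hx), smul_apply]
  simp only [smul_eq_mul]
  field_simp
  ring

/-- `IsShapeOperator` leaves `τ` free, but `D_X N` is tangent, so applying `dF` to the Weingarten
formula forces `τ X = 0`. On tangent vectors `ν` vanishes as well. -/
lemma IsShapeOperator.apply_eq (hF : ∀ x ∈ W, ContDiffAt ℝ ∞ F x)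
    (hH : ∀ x ∈ W, hessDet Ψ F x ≠ 0) (hU : ∀ x ∈ W, uFun Ψ F x ≠ 0)
    (hN : IsEquiaffineNormal Ψ F W N) (hx : x ∈ W) {S : tangent F x →ₗ[ℝ] tangent F x}
    (hS : IsShapeOperator F N x S) (X : tangent F x) :
    (S X : Space n) = shapeTensor Ψ F N x X := by
  obtain ⟨h, τ, hI⟩ := hS
  have h1 := hI.weingarten X
  have h2 : fderiv ℝ F x (fderiv ℝ N x X) = 0 := hN.fderiv_mem_tangent hx X
  have h3 : fderiv ℝ F x (S X : Space n) = 0 := (S X).2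
  have h4 : fderiv ℝ F x (X : Space n) = 0 := X.2
  have h5 : τ X = 0 := by
    rw [h1, map_add, map_neg, h3, map_smul, smul_eq_mul, neg_zero, zero_add,
      hN.fderiv_apply hF hH hU hx] at h2
    exact (mul_eq_zero.1 h2).resolve_right (neg_ne_zero.2 (uPow_pos (hU x hx)).ne')
  rw [h5, zero_smul, add_zero] at h1
  rw [shapeTensor, add_apply, neg_apply, h1, smul_apply, ContinuousLinearMap.smulRight_apply,
    conormal_eq, smul_apply, h4]
  simp

lemma shapeTensor_basisVec (hW : IsOpen W) (hF : ∀ x ∈ W, ContDiffAt ℝ ∞ F x)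
    (hH : ∀ x ∈ W, hessDet Ψ F x ≠ 0) (hU : ∀ x ∈ W, uFun Ψ F x ≠ 0)
    (hN : ∀ x ∈ W, N x = (-normalFactor Ψ F x) • hessGrad F x) (hx : x ∈ W)
    (hμ : muForm Ψ F x =
      ((uFun Ψ F x)⁻¹ * hessDet Ψ F x * (1 - aFun Ψ F x)) • fderiv ℝ F x)
    (i j : Fin (n + 1)) :
    shapeTensor Ψ F N x (basisVec i) j = shapeComponents Ψ F x i j := by
  have hev : ∀ᶠ y in 𝓝 x, ContDiffAt ℝ ∞ F y := eventually_of_mem (hW.mem_nhds hx) hF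
  have hFx := hF x hx
  have hU0 := hU x hx
  have hH0 := hH x hx
  have hdet := det_hess_ne_zero hH0
  have hf := (uPow_pos hU0).ne'
  have hNe : N =ᶠ[𝓝 x] fun y => (-normalFactor Ψ F y) • hessGrad F y :=
    eventually_of_mem (hW.mem_nhds hx) hN
  have hkd : DifferentiableAt ℝ (normalFactor Ψ F) x := by
    have h1 : normalFactor Ψ F =ᶠ[𝓝 x]
        fun y => uPow Ψ F y * hessDet Ψ F y * (uFun Ψ F y)⁻¹ := by
      filter_upwards [hW.mem_nhds hx] with y hy using normalFactor_eq (hU y hy)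
    refine DifferentiableAt.congr_of_eventuallyEq ?_ h1
    exact (((contDiffAt_uPow hFx hU0).mul (contDiffAt_hessDet hFx)).mul
      ((contDiffAt_uFun hFx).inv hU0)).differentiableAt (by simp)
  have hD := hkd.hasFDerivAt.neg.smul
    ((contDiffAt_hessGrad hFx hdet).differentiableAt (by simp)).hasFDerivAt
  have hDN : fderiv ℝ N x (basisVec i) j =
      -normalFactor Ψ F x * fderiv ℝ (hessGrad F) x (basisVec i) j -
        fderiv ℝ (normalFactor Ψ F) x (basisVec i) * hessGrad F x j := by
    rw [hNe.fderiv_eq]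
    refine (congrArg (fun m : Space n →L[ℝ] Space n => m (basisVec i) j) hD.fderiv).trans ?_
    simp
    ring
  rw [shapeTensor, add_apply, neg_apply, smul_apply, ContinuousLinearMap.smulRight_apply,
    Pi.add_apply, Pi.neg_apply, Pi.smul_apply, Pi.smul_apply, hDN, hN x hx, Pi.smul_apply,
    fderiv_hessGrad_apply hev hdet, fderiv_normalFactor_apply hev hH0 hU0, hμ, conormal_eq,
    shapeComponents]
  have hg : grad F x i = fderiv ℝ F x (basisVec i) := rfl
  have hp : pd i (hessDet Ψ F) x = fderiv ℝ (hessDet Ψ F) x (basisVec i) := rfl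
  rw [hg, hp]
  simp only [smul_apply, smul_eq_mul]
  -- The `F_i F^j` coefficient collects `-(n+1)(1-A)` from `-(n+1) μ` and `A` from `ν ⊗ N`, both
  -- times `H U⁻¹`; `hk` puts the second in that form, and the sum is `(n+2) A - (n+1)`.
  have hk : (uPow Ψ F x)⁻¹ * normalFactor Ψ F x = hessDet Ψ F x * (uFun Ψ F x)⁻¹ := by
    rw [normalFactor_eq hU0]
    field_simp
  linear_combination (normalFactor Ψ F x * aFun Ψ F x * fderiv ℝ F x (basisVec i) *
    hessGrad F x j) * hk

/-- By Jacobi's formula the contracted third derivatives equal `d log H(F^♯)` and cancel; then `F_i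
F^i = U/H` turns the last term into `(n+2) A - (n+1)`, and `tr δ = n+1` cancels the constant. -/
lemma sum_shapeComponents (hF : ContDiffAt ℝ ∞ F x) (hH : hessDet Ψ F x ≠ 0)
    (hU : uFun Ψ F x ≠ 0) :
    ∑ i, shapeComponents Ψ F x i i = ((n : ℝ) + 2) * normalFactor Ψ F x * aFun Ψ F x := by
  have h1 := fderiv_hessDet_apply (Ψ := Ψ) hF hH (hessGrad F x)
  have h2 : ∑ i, grad F x i * hessGrad F x i = uFun Ψ F x * (hessDet Ψ F x)⁻¹ := by
    rw [← fderiv_hessGrad hH, fderiv_apply_eq_dotProduct, dotProduct]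
    exact Finset.sum_congr rfl fun i _ => mul_comm _ _
  have h3 : ∑ i, pd i (hessDet Ψ F) x * hessGrad F x i =
      fderiv ℝ (hessDet Ψ F) x (hessGrad F x) := by
    rw [fderiv_apply_eq_dotProduct, dotProduct]
    exact Finset.sum_congr rfl fun i _ => mul_comm _ _
  have h4 : ∑ i, shapeComponents Ψ F x i i = normalFactor Ψ F x * (((n : ℝ) + 1)
      - (∑ i, ∑ p, ∑ q, third F x i p q * (hess F x)⁻¹ q i * hessGrad F x p)
      + ((hessDet Ψ F x)⁻¹ * (∑ i, pd i (hessDet Ψ F) x * hessGrad F x i)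
        + (uFun Ψ F x)⁻¹ * hessDet Ψ F x * (((n : ℝ) + 2) * aFun Ψ F x - ((n : ℝ) + 1)) *
          ∑ i, grad F x i * hessGrad F x i)) := by
    have h5 : ((n : ℝ) + 1) = ∑ _i : Fin (n + 1), (1 : ℝ) := by simp
    simp only [shapeComponents, ← Finset.mul_sum, if_true]
    congr 1
    rw [Finset.sum_add_distrib, Finset.sum_sub_distrib, ← h5]
    congr 1
    rw [Finset.mul_sum, Finset.mul_sum, ← Finset.sum_add_distrib]
    exact Finset.sum_congr rfl fun i _ => by ring
  rw [h4, ← h1, h2, h3]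
  field_simp
  ring

/-- `T` maps everything into the tangent space, so it induces zero on the quotient and its trace
equals that of its restriction. -/
lemma meanCurvature_eq {S : tangent F x →ₗ[ℝ] tangent F x} {T : Space n →L[ℝ] Space n}
    (hT : ∀ v, T v ∈ tangent F x) (hS : ∀ X : tangent F x, (S X : Space n) = T X) :
    meanCurvature S = 1 / (n : ℝ) * ∑ i, T (basisVec i) i := by
  have h1 : S = T.toLinearMap.restrict (p := tangent F x) (q := tangent F x)
      (fun v _ => hT v) := by
    ext1 X
    exact Subtype.ext (hS X)
  rw [meanCurvature, h1, LinearMap.trace_restrict_eq_of_forall_mem _ T.toLinearMap hT,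
    LinearMap.trace_eq_matrix_trace ℝ (Pi.basisFun ℝ (Fin (n + 1))), Matrix.trace]
  simp [Matrix.diag_apply, basisVec]

end Shape

end LevelSetAffine

/-! ### Assembly of the equivalences and the curvature formulas. -/

open LevelSetAffine in
theorem mainTheorem11 (n : ℕ) (hn : 1 ≤ n) (Ψ : VolForm n) (hΨ : Ψ ≠ 0)
    (Ω : Set (Space n)) (hΩ : IsOpen Ω) (hΩc : IsConnected Ω)
    (I : Set ℝ) (hI : IsOpen I) (hIc : IsConnected I)
    (F : Space n → ℝ) (hF : ContDiffOn ℝ ∞ F Ω)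
    (W : Set (Space n)) (hW : W = Ω ∩ F ⁻¹' I)
    (hH : ∀ x ∈ W, hessDet Ψ F x ≠ 0) (hU : ∀ x ∈ W, uFun Ψ F x ≠ 0) :
    (∃ N : Space n → Space n, IsEquiaffineNormal Ψ F W N) ∧
    ∀ N : Space n → Space n, IsEquiaffineNormal Ψ F W N →
      List.TFAE [
        ∀ r ∈ I, IsLocallyConstant (fun x : levelSet F W r => uFun Ψ F x),
        ∀ x ∈ W, ∀ u v, wedge (muForm Ψ F) (conormal Ψ F) x u v = 0,
        ∀ x ∈ W, muForm Ψ F x =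
          ((uFun Ψ F x)⁻¹ * hessDet Ψ F x * (1 - aFun Ψ F x)) • fderiv ℝ F x,
        ∀ x ∈ W, extD (conormal Ψ F) x = 0,
        FlowPreservesLevelSets F W N,
        ∀ x ∈ W, lieD N (conormal Ψ F) x = 0,
        ∀ x ∈ W, ∃ c : ℝ, N x = c • hessGrad F x,
        ∀ x ∈ W, N x = (-normalFactor Ψ F x) • hessGrad F x] ∧
      ((∀ r ∈ I, IsLocallyConstant (fun x : levelSet F W r => uFun Ψ F x)) →
        (∀ x ∈ W, ∃ S, IsShapeOperator F N x S) ∧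
        (∀ x ∈ W, ∀ S, IsShapeOperator F N x S →
          meanCurvature S = ((n : ℝ) + 2) / n * normalFactor Ψ F x * aFun Ψ F x ∧
          ∀ X : tangent F x, (S X : Space n) = shapeTensor Ψ F N x X) ∧
        (∀ x ∈ W, ∀ i j, shapeTensor Ψ F N x (basisVec i) j = shapeComponents Ψ F x i j) ∧
        (∀ x ∈ W, ∀ v, fderiv ℝ F x (shapeTensor Ψ F N x v) = 0)) := by
  have hWo : IsOpen W := hW ▸ hF.continuousOn.isOpen_inter_preimage hΩ hI
  have hWI : ∀ x ∈ W, F x ∈ I := by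
    rintro x hx
    rw [hW] at hx
    exact hx.2
  have hFW : ∀ x ∈ W, ContDiffAt ℝ ∞ F x := by
    intro x hx
    rw [hW] at hx
    exact hF.contDiffAt (hΩ.mem_nhds hx.1)
  refine ⟨exists_isEquiaffineNormal hWo hFW hH hU, fun N hN => ?_⟩
  have e1 := forall_isLocallyConstant_iff hWo hWI hFW hH hU
  have e2 : (∀ x ∈ W, ∀ u v, wedge (muForm Ψ F) (conormal Ψ F) x u v = 0) ↔
      ∀ x ∈ W, ∃ c : ℝ, muForm Ψ F x = c • fderiv ℝ F x :=
    forall₂_congr fun x hx => wedge_eq_zero_iff (hH x hx) (hU x hx)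
  have e3 : (∀ x ∈ W, muForm Ψ F x =
      ((uFun Ψ F x)⁻¹ * hessDet Ψ F x * (1 - aFun Ψ F x)) • fderiv ℝ F x) ↔
      ∀ x ∈ W, ∃ c : ℝ, muForm Ψ F x = c • fderiv ℝ F x :=
    forall₂_congr fun x hx => muForm_eq_iff (hH x hx) (hU x hx)
  have e4 : (∀ x ∈ W, extD (conormal Ψ F) x = 0) ↔
      ∀ x ∈ W, ∀ u v, wedge (muForm Ψ F) (conormal Ψ F) x u v = 0 :=
    forall₂_congr fun x hx => extD_conormal_eq_zero_iff (hFW x hx) (hU x hx)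
  have e5 := flowPreservesLevelSets_iff hWo hFW hH hU hN
  have e6 : (∀ x ∈ W, lieD N (conormal Ψ F) x = 0) ↔
      ∀ x ∈ W, ∃ c : ℝ, muForm Ψ F x = c • fderiv ℝ F x :=
    forall₂_congr fun x hx => lieD_conormal_eq_zero_iff hWo hFW hH hU hN hx
  have e7 : (∀ x ∈ W, ∃ c : ℝ, N x = c • hessGrad F x) ↔
      ∀ x ∈ W, ∃ c : ℝ, muForm Ψ F x = c • fderiv ℝ F x :=
    forall₂_congr fun x hx => eq_smul_hessGrad_iff hWo hFW hH hU hN hx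
  have e8 : (∀ x ∈ W, N x = (-normalFactor Ψ F x) • hessGrad F x) ↔
      ∀ x ∈ W, ∃ c : ℝ, N x = c • hessGrad F x :=
    forall₂_congr fun x hx => eq_neg_normalFactor_smul_iff hFW hH hU hN hx
  refine ⟨?_, fun h => ?_⟩
  · tfae_have 1 ↔ 2 := e1.trans e2.symm
    tfae_have 3 ↔ 2 := e3.trans e2.symm
    tfae_have 4 ↔ 2 := e4
    tfae_have 5 ↔ 2 := e5.trans e2.symm
    tfae_have 6 ↔ 2 := e6.trans e2.symm
    tfae_have 7 ↔ 2 := e7.trans e2.symm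
    tfae_have 8 ↔ 7 := e8
    tfae_finish
  · have hμ := e3.2 (e1.1 h)
    have hNk := e8.2 (e7.2 (e1.1 h))
    have hcomp : ∀ x ∈ W, ∀ i j,
        shapeTensor Ψ F N x (basisVec i) j = shapeComponents Ψ F x i j :=
      fun x hx => shapeTensor_basisVec hWo hFW hH hU hNk hx (hμ x hx)
    have htan : ∀ x ∈ W, ∀ v, fderiv ℝ F x (shapeTensor Ψ F N x v) = 0 :=
      fun x hx => fderiv_shapeTensor hWo hFW hH hU hN hx
    refine ⟨fun x hx => ?_, fun x hx S hS => ?_, hcomp, htan⟩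
    · obtain ⟨h, S, τ, hInd, -⟩ := hN.normalized x hx
      exact ⟨S, h, τ, hInd⟩
    · have hSX := hS.apply_eq hFW hH hU hN hx
      refine ⟨?_, hSX⟩
      rw [meanCurvature_eq (htan x hx) hSX, Finset.sum_congr rfl fun i _ => hcomp x hx i i,
        sum_shapeComponents (hFW x hx) (hH x hx) (hU x hx)]
      ring
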